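/- Let $n\ge 2$, $X_n=\{0,\dots,n-1\}$, $\mathfrak C_n=X_n^\omega$ with the product topology and the lexicographic order, and, for $1\le r<n$, let $\mathfrak C_{n,r}=\{\dot a x: 0\le a<r,\ x\in\mathfrak C_n\}$ be the disjoint union of $r$ copies of $\mathfrak C_n$. For a finite word $v$ over $X_n$ let $U_v\subseteq\mathfrak C_n$ be the cone of infinite words with prefix $v$. A (possibly asynchronous) transducer $T$ over $X_n$ consists of a set $Q_T$ of states, a transition function $\pi: X_n\times Q_T\to Q_T$ and an output function $\lambda: X_n\times Q_T\to X_n^*$ such that infinite inputs give infinite outputs; each state $q$ induces a map $h_q:\mathfrak C_n\to\mathfrak C_n$. Transducers are considered up to isomorphism. An initial transducer $A$ over $\mathfrak C_{n,r}$ has an initial state, from which exactly the letters $\dot 0,\dots,\dot{(r-1)}$ are read and to which no transition returns, and further states, from which the letters of $X_n$ are read. These further states are a disjoint union $R\sqcup S$ with $R$ finite: moves from the initial state or from $R$ into $R$ have empty output, moves from there into $S$ output a word $\dot b w$ with $w\in X_n^*$, $S$ is a transducer over $X_n$, and no state of $R$ lies on a cycle. It induces a map $\mathfrak C_{n,r}\to\mathfrak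 C_{n,r}$. It is minimal if every state is accessible, every single-letter output (including those from the initial state) is the greatest common prefix of all infinite outputs produced after reading that letter from that state, and distinct states induce distinct maps. A transducer is synchronizing at level $k$ if the (non-initial) state reached by reading a word of length $k$ over $X_n$ from any (non-initial) state depends only on the word; this is the state forced by the word. The core $\operatorname{core}(A)$ of a synchronizing transducer $A$ is the transducer over $X_n$ whose states are the states forced by words of synchronizing length. Let $\mathcal B_{n,r}$ be the group of homeomorphisms $h$ of $\mathfrak C_{n,r}$ such that both $h$ and $h^{-1}$ are induced by finite synchronizing initial transducers; identify $h\in\mathcal B_{n,r}$ with the minimal transducer inducing it, which is again finite and synchronizing. Let $\simeq$ be the equivalence relation on $\mathfrak C_{n,r}$ that identifies two points when they represent the same point of the circle $\mathbb R/r\mathbb Z$ in base $n$, and let $\mathcal{TB}_{n,r}$ be the set of elements of $\mathcal B_{n,r}$ that preserve $\simeq$. Put $$\mathcal O_{n,r}=\{\operatorname{core}(A): A\in\mathcal B_{n,r}\},\qquad \mathcal{TO}_{n,r}=\{\operatorname{core}(A): A\in\mathcal{TB}_{n,r}\},\qquad \mathcal O_n=\bigcup_{1\le s<n}\mathcal O_{n,s},$$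 and let $\mathcal{TO}_n$ be the set of $T\in\mathcal O_n$ such that either all maps $h_q$, $q\in Q_T$, preserve the lexicographic order of $\mathfrak C_n$, or all of them reverse it. For $T\in\mathcal O_n$ and a state $q$ of $T$, let $m_q$ be the smallest size of a finite set $V$ of words over $X_n$ with $\bigcup_{v\in V}U_v=h_q(\mathfrak C_n)$. Let $k$ be the minimal synchronizing level of $T$, and for a word $x\in X_n^k$ let $q_x$ be the state of $T$ forced by $x$. The signature of $T$ is $\operatorname{sig}(T)=\sum_{x\in X_n^k}m_{q_x}$. **Proposition.** Let $1\le r<n$. (a) If $T\in\mathcal{TO}_n$, then $T\in\mathcal{TO}_{n,r}$ if and only if $r\cdot\operatorname{sig}(T)\equiv r \pmod{n-1}$. (b) If $T\in\mathcal O_n$, then $T\in\mathcal O_{n,r}$ if and only if $r\cdot\operatorname{sig}(T)\equiv r\pmod{n-1}$. In both cases the congruence is equivalent to $r(\operatorname{sig}(T)-1)\equiv 0\pmod{n-1}$. -/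

import Mathlib

namespace HT

/-! ## Words and Cantor space -/

/-- The Cantor space `X_n^ω` on the alphabet `X_n = {0, …, n-1}`, with the product topology. -/
abbrev Cantor (n : ℕ) : Type := ℕ → Fin n

/-- The disjoint union of `r` copies of `X_n^ω`: the point `(a, x)` is the sequence `ȧ x`. -/
abbrev CantorR (n r : ℕ) : Type := Fin r × Cantor n

/-- The prefix of length `k` of an infinite word. -/
def pre {n : ℕ} (x : Cantor n) (k : ℕ) : List (Fin n) := (List.range k).map x

/-- The infinite word `w x`. -/
def app {n : ℕ} (w : List (Fin n)) (x : Cantor n) : Cantor n :=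
  fun i => if h : i < w.length then w[i] else x (i - w.length)

/-- The infinite word `x` with its first letter removed. -/
def shift {n : ℕ} (x : Cantor n) : Cantor n := fun i => x (i + 1)

/-- The cone `U_w` of all infinite words with prefix `w`. -/
def cone {n : ℕ} (w : List (Fin n)) : Set (Cantor n) := {x | pre x w.length = w}

/-- `w` is the greatest common prefix of the elements of `Z ⊆ X_n^ω`. -/
def IsGCP {n : ℕ} (w : List (Fin n)) (Z : Set (Cantor n)) : Prop :=
  Z ⊆ cone w ∧ ∀ v : List (Fin n), Z ⊆ cone v → v.length ≤ w.length

/-- Words over `ṙ ⊔ X_n` that are empty (`none`) or of the form `ȧ w` (`some (a, w)`). -/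
abbrev WordR (n r : ℕ) : Type := Option (Fin r × List (Fin n))

/-- The cone of a word: everything for the empty word, and `ȧ U_w` for `ȧ w`. -/
def coneR {n r : ℕ} : WordR n r → Set (CantorR n r)
  | none => Set.univ
  | some (a, w) => {z | z.1 = a ∧ z.2 ∈ cone w}

/-- The length of a word; `ȧ` counts as one letter. -/
def lengthR {n r : ℕ} : WordR n r → ℕ
  | none => 0
  | some (_, w) => w.length + 1

/-- `w` is the greatest common prefix of the elements of `Z`. -/
def IsGCPR {n r : ℕ} (w : WordR n r) (Z : Set (CantorR n r)) : Prop :=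
  Z ⊆ coneR w ∧ ∀ v : WordR n r, Z ⊆ coneR v → lengthR v ≤ lengthR w

/-! ## Reading words and synchronization -/

/-- The state reached from a state by reading a finite word. -/
def readState {n : ℕ} {Q : Type} (step : Fin n → Q → Q) : List (Fin n) → Q → Q
  | [], q => q
  | i :: w, q => readState step w (step i q)

/-- The output produced when a finite word is read from a state. -/
def readOut {n : ℕ} {Q : Type} (step : Fin n → Q → Q) (out : Fin n → Q → List (Fin n)) :
    List (Fin n) → Q → List (Fin n)
  | [], _ => []
  | i :: w, q => out i q ++ readOut step out w (step i q)

/-- Synchronizing at level `k`: the state reached by reading a word of length `k` depends only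
on the word, through some map `s`. -/
def SyncAt {n : ℕ} {Q : Type} (step : Fin n → Q → Q) (k : ℕ) : Prop :=
  ∃ s : List.Vector (Fin n) k → Q, ∀ (w : List.Vector (Fin n) k) (q : Q),
    readState step w.val q = s w

theorem readState_append {n : ℕ} {Q : Type} (step : Fin n → Q → Q) (u v : List (Fin n)) (q : Q) :
    readState step (u ++ v) q = readState step v (readState step u q) := by
  induction u generalizing q with
  | nil => rfl
  | cons i u ih => simp [readState, ih]

theorem SyncAt.succ {n : ℕ} {Q : Type} {step : Fin n → Q → Q} {k : ℕ} (h : SyncAt step k) :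
    SyncAt step (k + 1) := by
  obtain ⟨s, hs⟩ := h
  refine ⟨fun w => s w.tail, fun w q => ?_⟩
  obtain ⟨_ | ⟨i, w⟩, hw⟩ := w
  · simp at hw
  · exact hs ⟨w, by simpa using hw⟩ (step i q)

/-! ## Non-initial transducers over `X_n` -/

/-- A transducer with input and output alphabet `X_n`; from every state, every infinite input
produces an infinite output. -/
structure Transducer (n : ℕ) where
  Q : Type
  step : Fin n → Q → Q
  out : Fin n → Q → List (Fin n)
  productive : ∀ (q : Q) (x : Cantor n) (m : ℕ), ∃ k, m < (readOut step out (pre x k) q).length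

namespace Transducer

variable {n : ℕ}

/-- The map `h_q : X_n^ω → X_n^ω` induced by the state `q`: the `i`-th letter of the output is
read off from any prefix of the input that is long enough. -/
noncomputable def act (T : Transducer n) (q : T.Q) (x : Cantor n) : Cantor n := fun i =>
  (readOut T.step T.out (pre x (T.productive q x i).choose) q)[i]'(T.productive q x i).choose_spec

/-- Isomorphism of transducers: a bijection of the states that respects transitions and outputs. -/
structure Iso (T U : Transducer n) where
  toEquiv : T.Q ≃ U.Q
  map_step : ∀ (i : Fin n) (q : T.Q), toEquiv (T.step i q) = U.step i (toEquiv q)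
  map_out : ∀ (i : Fin n) (q : T.Q), T.out i q = U.out i (toEquiv q)

/-- All states induce maps that preserve the lexicographic order. -/
def PreservesLex (T : Transducer n) : Prop :=
  ∀ (q : T.Q) (x y : Cantor n), toLex x < toLex y → toLex (T.act q x) < toLex (T.act q y)

/-- All states induce maps that reverse the lexicographic order. -/
def ReversesLex (T : Transducer n) : Prop :=
  ∀ (q : T.Q) (x y : Cantor n), toLex x < toLex y → toLex (T.act q y) < toLex (T.act q x)

/-- `m_q`: the smallest size of a finite set of words whose cones are contained in the image of
`h_q` and cover it. -/
noncomputable def coverSize (T : Transducer n) (q : T.Q) : ℕ :=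
  sInf {m | ∃ V : Finset (List (Fin n)), V.card = m ∧
    (∀ v ∈ V, cone v ⊆ Set.range (T.act q)) ∧ Set.range (T.act q) ⊆ ⋃ v ∈ V, cone v}

open Classical in
/-- The signature: with `k` the minimal synchronizing level, the sum over all words `w` of
length `k` of `m_q`, where `q` is the state forced by `w`.
(It is set to `0` for transducers that are not synchronizing.) -/
noncomputable def sig (T : Transducer n) : ℕ :=
  if h : ∃ k, SyncAt T.step k then
    ∑ w : List.Vector (Fin n) (Nat.find h), T.coverSize ((Nat.find_spec h).choose w)
  else 0

end Transducer

/-! ## Initial transducers over the disjoint union of `r` copies of `X_n^ω` -/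

/-- The transition function on the disjoint union of `R` and `S`, from the moves made in the states
of `R` and the transitions of the states of `S`. -/
def stepSum {n r : ℕ} {R S : Type} (stepR : Fin n → R → R ⊕ (S × Fin r × List (Fin n)))
    (stepS : Fin n → S → S) (i : Fin n) : R ⊕ S → R ⊕ S
  | Sum.inl q => Sum.map id Prod.fst (stepR i q)
  | Sum.inr s => Sum.inr (stepS i s)

/-- An initial transducer over `CantorR n r`. Besides the initial state, from which exactly the
letters of `ṙ` are read and to which no transition leads, the states are split in `R` and
`S = base.Q`; from these the letters of `X_n` are read. A transition from the initial state or
from a state of `R` either leads to a state of `R` without output (`Sum.inl q`), or leads to a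
state `s` of `S` with output `ḃ w` (`Sum.inr (s, b, w)`). The states of `S` form a transducer
over `X_n`. There are finitely many states in `R`, and none of them lies on a cycle. -/
structure TransducerR (n r : ℕ) where
  R : Type
  finite_R : Finite R
  base : Transducer n
  init : Fin r → R ⊕ (base.Q × Fin r × List (Fin n))
  stepR : Fin n → R → R ⊕ (base.Q × Fin r × List (Fin n))
  acyclic : ∀ (w : List (Fin n)) (q : R), w ≠ [] →
    readState (stepSum stepR base.step) w (Sum.inl q) ≠ Sum.inl q

namespace TransducerR

variable {n r : ℕ}

/-- The result of a transition from the initial state or from a state of `R`. -/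
abbrev Move (A : TransducerR n r) : Type := A.R ⊕ (A.base.Q × Fin r × List (Fin n))

/-- The state to which a move leads. -/
def target (A : TransducerR n r) : A.Move → A.R ⊕ A.base.Q := Sum.map id Prod.fst

/-- The output of a move. -/
def output (A : TransducerR n r) : A.Move → WordR n r
  | Sum.inl _ => none
  | Sum.inr (_, b, w) => some (b, w)

/-- The transition function on the non-initial states. -/
def step (A : TransducerR n r) : Fin n → A.R ⊕ A.base.Q → A.R ⊕ A.base.Q :=
  stepSum A.stepR A.base.step

/-- `A.Emits m x z`: the output `z` is produced, in total, by making the move `m` and then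
reading `x` from the state reached. For `q` in `R`, `A.Emits (Sum.inl q)` is the graph of `h_q`. -/
inductive Emits (A : TransducerR n r) : A.Move → Cantor n → CantorR n r → Prop
  | leave (s : A.base.Q) (b : Fin r) (w : List (Fin n)) (x : Cantor n) :
      Emits A (Sum.inr (s, b, w)) x (b, app w (A.base.act s x))
  | stay (q : A.R) (x : Cantor n) (z : CantorR n r) :
      Emits A (A.stepR (x 0) q) (shift x) z → Emits A (Sum.inl q) x z

/-- The map induced by the initial state is `h`. -/
def Represents (A : TransducerR n r) (h : CantorR n r → CantorR n r) : Prop :=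
  ∀ (a : Fin r) (x : Cantor n), A.Emits (A.init a) x (h (a, x))

/-- Minimality: all states are accessible, there are no states of incomplete response, and
distinct states are not `ω`-equivalent (the initial state, the states of `R` and those of `S`
induce maps with different domains or codomains). -/
structure IsMinimal (A : TransducerR n r) : Prop where
  accessible : ∀ p : A.R ⊕ A.base.Q, ∃ (a : Fin r) (w : List (Fin n)),
    readState A.step w (A.target (A.init a)) = p
  complete_init : ∀ a : Fin r,
    IsGCPR (A.output (A.init a)) {z | ∃ x, A.Emits (A.init a) x z}
  complete_R : ∀ (i : Fin n) (q : A.R),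
    IsGCPR (A.output (A.stepR i q)) {z | ∃ x, A.Emits (A.stepR i q) x z}
  complete_S : ∀ (i : Fin n) (s : A.base.Q),
    IsGCP (A.base.out i s) {z | ∃ x : Cantor n, x 0 = i ∧ A.base.act s x = z}
  reduced_R : ∀ q q' : A.R,
    (∀ x z, A.Emits (Sum.inl q) x z ↔ A.Emits (Sum.inl q') x z) → q = q'
  reduced_S : ∀ s s' : A.base.Q, A.base.act s = A.base.act s' → s = s'

/-- There are finitely many states. -/
def IsFinite (A : TransducerR n r) : Prop := Finite (A.R ⊕ A.base.Q)

/-- Words over `X_n` of some fixed length force the non-initial state that is reached.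
(Words that begin with a letter of `ṙ` can be read from the initial state only.) -/
def Synchronizing (A : TransducerR n r) : Prop := ∃ k, SyncAt A.step k

/-- The states forced by words of synchronizing length. They all lie in `S`, as long paths leave
`R`. -/
def coreStates (A : TransducerR n r) : Set A.base.Q :=
  {s | ∃ k, SyncAt A.step k ∧ ∃ w : List.Vector (Fin n) k,
    ∀ p, readState A.step w.val p = Sum.inr s}

theorem step_mem_coreStates (A : TransducerR n r) (i : Fin n) {s : A.base.Q}
    (hs : s ∈ A.coreStates) : A.base.step i s ∈ A.coreStates := by
  obtain ⟨k, hk, w, hw⟩ := hs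
  refine ⟨k + 1, hk.succ, ⟨w.val ++ [i], by simp⟩, fun p => ?_⟩
  rw [readState_append, hw]
  rfl

/-- The core, as a non-initial transducer. -/
def core (A : TransducerR n r) : Transducer n where
  Q := A.coreStates
  step i s := ⟨A.base.step i s, A.step_mem_coreStates i s.2⟩
  out i s := A.base.out i s
  productive q x m := by
    obtain ⟨k, hk⟩ := A.base.productive q x m
    refine ⟨k, hk.trans_eq (congrArg List.length ?_)⟩
    clear hk
    generalize pre x k = w
    induction w generalizing q with
    | nil => rfl
    | cons i w ih => simp only [readOut]; rw [← ih]

end TransducerR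

/-! ## The equivalence relation whose quotient is the circle -/

/-- `x` and `y` are the two `n`-ary expansions (the smaller one first, except at the base point)
of one point of the circle `ℝ / rℤ`:
`x = w (i-1) (n-1) (n-1) …` and `y = w i 0 0 …`, or `x` and `y` end one copy of `X_n^ω` and
start the next one, in the cyclic order of the copies. -/
def Adjacent {n r : ℕ} (x y : CantorR n r) : Prop :=
  (x.1 = y.1 ∧ ∃ m, (∀ j < m, x.2 j = y.2 j) ∧ (x.2 m : ℕ) + 1 = y.2 m ∧
    ∀ j > m, (x.2 j : ℕ) + 1 = n ∧ (y.2 j : ℕ) = 0) ∨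
  (((x.1 : ℕ) + 1) % r = y.1 ∧ ∀ j, (x.2 j : ℕ) + 1 = n ∧ (y.2 j : ℕ) = 0)

/-- The relation `≃`: equality in the circle `ℝ / rℤ`. -/
def CircleEq {n r : ℕ} (x y : CantorR n r) : Prop := x = y ∨ Adjacent x y ∨ Adjacent y x

/-! ## The groups -/

/-- `A` is a finite minimal bi-synchronizing transducer, and `h` is the homeomorphism that it
represents: `h` lies in the group `B_{n,r}`, and `A` is its minimal transducer. -/
structure IsBiSync {n r : ℕ} (A : TransducerR n r) (h : CantorR n r ≃ₜ CantorR n r) : Prop where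
  finite : A.IsFinite
  minimal : A.IsMinimal
  represents : A.Represents h
  sync : A.Synchronizing
  sync_inv : ∃ B : TransducerR n r, B.IsFinite ∧ B.Represents h.symm ∧ B.Synchronizing

/-- `O_{n,r}`: the cores, up to isomorphism, of the elements of `B_{n,r}`. -/
def Onr (n r : ℕ) : Set (Transducer n) :=
  {T | ∃ (A : TransducerR n r) (h : CantorR n r ≃ₜ CantorR n r),
    IsBiSync A h ∧ Nonempty (T.Iso A.core)}

/-- `TO_{n,r}`: the cores, up to isomorphism, of the elements of `B_{n,r}` that preserve `≃`. -/
def TOnr (n r : ℕ) : Set (Transducer n) :=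
  {T | ∃ (A : TransducerR n r) (h : CantorR n r ≃ₜ CantorR n r),
    IsBiSync A h ∧ (∀ x y, CircleEq x y → CircleEq (h x) (h y)) ∧ Nonempty (T.Iso A.core)}

/-- `O_n`, the union of the `O_{n,r}` for `1 ≤ r < n`. -/
def On (n : ℕ) : Set (Transducer n) := {T | ∃ r, 1 ≤ r ∧ r < n ∧ T ∈ Onr n r}

/-- `TO_n`: the elements of `O_n` that preserve or reverse the lexicographic order. -/
def TOn (n : ℕ) : Set (Transducer n) := {T | T ∈ On n ∧ (T.PreservesLex ∨ T.ReversesLex)}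

end HT

/-!
Every element `h` of `B_{n,r}` acts locally by the states of its core `T`: if the word `w` is long
enough, it forces a state `q` of `T`, and `h` maps `ȧ w x` to `ḃ u h_q(x)`, where `ḃ u` depends on
`ȧ w` only. This notion, `Transducer.LocallyActs`, carries both directions.

The congruence is necessary (`IsCoreOf.mul_sig_modEq`): the images of the cones `ȧ U_w`, for all
words `w` of one large length, partition the `r` copies of Cantor space, and the image of `ȧ U_w`
is a disjoint union of `m_q` cones, up to a prefix. In total these are `r · n ^ d · sig(T)` cones
for some `d`, and the number of cones in a partition of the `r` copies is always `r` modulo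
`n - 1` (`card_modEq_of_partition`), as splitting a cone into its `n` children does not change the
number modulo `n - 1`. The image of `h_q` is a finite union of cones because `h_q` has local
inverses given by the states of a transducer for `h⁻¹` (`IsCoreOf.exists_local_inverse`).

The congruence is sufficient (`IsCoreOf.exists_twist`): the map `ȧ x y ↦ ȧ x h_q(y)`, where `x` has
the minimal synchronizing length and forces `q`, is injective, and its image consists of
`r · sig(T)` disjoint cones. By the congruence there is a partition of the `r` copies of Cantor
space into as many cones. Replacing the prefixes of the former cones by those of the latter
produces a homeomorphism that acts locally by the states of `T`, and whose inverse acts locally by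
the states of a finite transducer. If the cones are matched in lexicographic order and all `h_q`
preserve the order, so does the homeomorphism; if all `h_q` reverse the order, the prefix `ȧ x` is
reversed letter by letter, and the homeomorphism reverses the order. In both cases it respects `≃`,
whose nontrivial pairs are the pairs of neighbours in the order together with the pair of the last
and the first point (`adjacent_iff`).

It remains to see that a homeomorphism that acts locally by the states of a finite transducer has a
finite minimal synchronizing transducer with the expected core (`IsCoreOf.exists_isBiSync`). The
states of this transducer are the residual maps of the homeomorphism at all finite prefixes, with
the greatest common prefix of the outputs removed (`Admissible.minimal`).
-/

namespace HT

/-! ### Finite prefixes of infinite words -/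

section Words

variable {n : ℕ}

@[simp] theorem length_pre (x : Cantor n) (k : ℕ) : (pre x k).length = k := by simp [pre]

theorem getElem_pre (x : Cantor n) (k i : ℕ) (h : i < (pre x k).length) : (pre x k)[i] = x i := by
  simp [pre]

theorem app_of_lt (w : List (Fin n)) (x : Cantor n) {i : ℕ} (h : i < w.length) :
    app w x i = w[i] := by simp [app, h]

theorem app_of_le (w : List (Fin n)) (x : Cantor n) {i : ℕ} (h : w.length ≤ i) :
    app w x i = x (i - w.length) := by simp [app, Nat.not_lt.mpr h]

@[simp] theorem app_length_add (w : List (Fin n)) (x : Cantor n) (i : ℕ) :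
    app w x (w.length + i) = x i := by
  rw [app_of_le _ _ (Nat.le_add_right _ _)]; simp

@[simp] theorem app_nil (x : Cantor n) : app [] x = x := by
  funext i; simp [app]

theorem app_append (u v : List (Fin n)) (x : Cantor n) : app (u ++ v) x = app u (app v x) := by
  funext i
  by_cases h : i < u.length
  · rw [app_of_lt _ _ h, app_of_lt _ _ (by simp; omega), List.getElem_append_left h]
  · push Not at h
    rw [app_of_le u _ h]
    by_cases h' : i < (u ++ v).length
    · rw [app_of_lt _ _ h', app_of_lt _ _ (by simp at h'; omega), List.getElem_append_right h]
    · push Not at h'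
      rw [app_of_le _ _ h', app_of_le _ _ (by simp at h'; omega)]
      congr 1
      simp
      omega

theorem app_cons (i : Fin n) (w : List (Fin n)) (x : Cantor n) :
    app (i :: w) x = app [i] (app w x) := app_append [i] w x

@[simp] theorem app_cons_zero (i : Fin n) (w : List (Fin n)) (x : Cantor n) :
    app (i :: w) x 0 = i := by simp [app]

@[simp] theorem shift_app_cons (i : Fin n) (w : List (Fin n)) (x : Cantor n) :
    shift (app (i :: w) x) = app w x := by
  funext j; simp [shift, app]

theorem app_zero_shift (x : Cantor n) : app [x 0] (shift x) = x := by
  funext j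
  cases j <;> simp [app, shift]

/-- The infinite word `x` with its first `k` letters removed. -/
def tail (k : ℕ) (x : Cantor n) : Cantor n := fun i => x (i + k)

theorem app_pre_tail (x : Cantor n) (k : ℕ) : app (pre x k) (tail k x) = x := by
  funext i
  by_cases h : i < k
  · rw [app_of_lt _ _ (by simpa using h), getElem_pre]
  · rw [app_of_le _ _ (by simpa using h)]
    simp [tail]; congr 1; omega

@[simp] theorem tail_app (w : List (Fin n)) (x : Cantor n) : tail w.length (app w x) = x := by
  funext i
  rw [tail, add_comm, app_length_add]

@[simp] theorem pre_app (w : List (Fin n)) (x : Cantor n) : pre (app w x) w.length = w := by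
  apply List.ext_getElem
  · simp
  · intro i h1 h2
    rw [getElem_pre, app_of_lt _ _ h2]

theorem app_mem_cone (w : List (Fin n)) (x : Cantor n) : app w x ∈ cone w := pre_app w x

theorem mem_cone_iff {w : List (Fin n)} {x : Cantor n} : x ∈ cone w ↔ ∃ y, x = app w y := by
  constructor
  · intro h
    refine ⟨tail w.length x, ?_⟩
    have h' : pre x w.length = w := h
    conv_rhs => rw [← h', length_pre]
    rw [app_pre_tail]
  · rintro ⟨y, rfl⟩
    exact app_mem_cone w y

theorem mem_cone_iff_getElem {w : List (Fin n)} {x : Cantor n} :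
    x ∈ cone w ↔ ∀ (i : ℕ) (h : i < w.length), x i = w[i] := by
  constructor
  · intro h i hi
    obtain ⟨y, rfl⟩ := mem_cone_iff.1 h
    exact app_of_lt w y hi
  · intro h
    apply List.ext_getElem
    · simp
    · intro i h1 h2
      rw [getElem_pre, h]

theorem mem_cone_pre (x : Cantor n) (k : ℕ) : x ∈ cone (pre x k) := by simp [cone]

theorem app_injective (w : List (Fin n)) : Function.Injective (app w) := fun x y h => by
  rw [← tail_app w x, h, tail_app]

theorem eq_append_of_app_eq_app {u v : List (Fin n)} {x y : Cantor n} (h : u.length ≤ v.length)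
    (e : app u x = app v y) : ∃ w, v = u ++ w ∧ x = app w y := by
  have h1 : v = u ++ v.drop u.length := by
    conv_lhs => rw [← List.take_append_drop u.length v]
    congr 1
    apply List.ext_getElem
    · simp [h]
    · intro i h1 h2
      rw [List.getElem_take, ← app_of_lt v y (by omega), ← e, app_of_lt]
  refine ⟨v.drop u.length, h1, app_injective u ?_⟩
  rw [e, ← app_append, ← h1]

theorem app_eq_app_of_length {u v : List (Fin n)} {x y : Cantor n} (h : u.length = v.length)
    (e : app u x = app v y) : u = v ∧ x = y := by
  obtain ⟨w, rfl, rfl⟩ := eq_append_of_app_eq_app h.le e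
  have : w = [] := by simpa using h
  subst this
  simp

theorem cone_subset_of_mem {u v : List (Fin n)} {x : Cantor n} (h : u.length ≤ v.length)
    (hu : x ∈ cone u) (hv : x ∈ cone v) : cone v ⊆ cone u := by
  obtain ⟨y, rfl⟩ := mem_cone_iff.1 hu
  obtain ⟨z, e⟩ := mem_cone_iff.1 hv
  obtain ⟨w, rfl, -⟩ := eq_append_of_app_eq_app h e
  intro z hz
  obtain ⟨t, rfl⟩ := mem_cone_iff.1 hz
  rw [app_append]
  exact app_mem_cone _ _

theorem continuous_app (w : List (Fin n)) : Continuous (app w) := by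
  refine continuous_pi fun i => ?_
  by_cases h : i < w.length
  · simp only [app, h, dite_true]; exact continuous_const
  · simp only [app, h, dite_false]; exact continuous_apply _

theorem continuous_tail (k : ℕ) : Continuous (tail k : Cantor n → Cantor n) :=
  continuous_pi fun i => continuous_apply (i + k)

theorem isOpen_cone (w : List (Fin n)) : IsOpen (cone w) := by
  have : cone w = ⋂ i : Fin w.length, {x : Cantor n | x i = w[i]} := by
    ext x
    rw [mem_cone_iff_getElem]
    simp only [Set.mem_iInter, Set.mem_ofPred_eq]
    exact ⟨fun h i => h i i.2, fun h i hi => h ⟨i, hi⟩⟩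
  rw [this]
  refine isOpen_iInter_of_finite fun i => ?_
  exact (isOpen_discrete ({w[i]} : Set (Fin n))).preimage
    (continuous_apply (A := fun _ => Fin n) (i : ℕ))

/-- Continuity into Cantor space means that any finite number of letters of the output is
determined by a finite prefix of the input. -/
theorem exists_pre_mapsTo_cone {f : Cantor n → Cantor n} (hf : Continuous f) (x : Cantor n)
    (m : ℕ) :
    ∃ k, ∀ y ∈ cone (pre x k), f y ∈ cone (pre (f x) m) := by
  have h1 : f ⁻¹' cone (pre (f x) m) ∈ nhds x :=
    ((isOpen_cone _).preimage hf).mem_nhds (mem_cone_pre _ _)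
  rw [nhds_pi, Filter.mem_pi] at h1
  obtain ⟨I, hI, t, ht, hsub⟩ := h1
  obtain ⟨k, hk⟩ := hI.bddAbove
  refine ⟨k + 1, fun y hy => hsub fun i hi => ?_⟩
  have := mem_cone_iff_getElem.1 hy i (by simpa using hk hi)
  rw [getElem_pre] at this
  rw [this]
  exact mem_of_mem_nhds (ht i)

theorem continuous_of_exists_pre {f : Cantor n → Cantor n}
    (hf : ∀ x m, ∃ k, ∀ y ∈ cone (pre x k), f y ∈ cone (pre (f x) m)) : Continuous f := by
  refine continuous_pi fun i => ?_
  rw [continuous_iff_continuousAt]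
  intro x
  obtain ⟨k, hk⟩ := hf x (i + 1)
  have : ∀ᶠ y in nhds x, f y i = f x i := by
    filter_upwards [(isOpen_cone (pre x k)).mem_nhds (mem_cone_pre _ _)] with y hy
    have := mem_cone_iff_getElem.1 (hk y hy) i (by simp)
    rwa [getElem_pre] at this
  exact (continuousAt_const (y := f x i)).congr (this.mono fun y hy => hy.symm)

end Words

/-! ### The maps induced by the states of a transducer -/

section Read

variable {n : ℕ} {Q : Type} (step : Fin n → Q → Q) (out : Fin n → Q → List (Fin n))

theorem readOut_append (u v : List (Fin n)) (q : Q) :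
    readOut step out (u ++ v) q =
      readOut step out u q ++ readOut step out v (readState step u q) := by
  induction u generalizing q with
  | nil => rfl
  | cons i u ih => simp [readOut, readState, ih, List.append_assoc]

theorem app_readOut {φ : Q → Cantor n → Cantor n}
    (hφ : ∀ i q y, φ q (app [i] y) = app (out i q) (φ (step i q) y)) (w : List (Fin n)) (q : Q)
    (y : Cantor n) : φ q (app w y) = app (readOut step out w q) (φ (readState step w q) y) := by
  induction w generalizing q with
  | nil => simp [readOut, readState]
  | cons i w ih => rw [app_cons, hφ, ih, readOut, readState, app_append]

theorem SyncAt.mono {step : Fin n → Q → Q} {k l : ℕ} (h : SyncAt step k) (hkl : k ≤ l) :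
    SyncAt step l := by
  induction l, hkl using Nat.le_induction with
  | base => exact h
  | succ l _ ih => exact ih.succ

theorem SyncAt.readState_eq {step : Fin n → Q → Q} {k : ℕ} (h : SyncAt step k) {w : List (Fin n)}
    (hw : k ≤ w.length) (p q : Q) : readState step w p = readState step w q := by
  obtain ⟨s, hs⟩ := h.mono hw
  rw [hs ⟨w, rfl⟩, hs ⟨w, rfl⟩]

theorem syncAt_of_readState_eq {step : Fin n → Q → Q} {k : ℕ} [Nonempty Q]
    (h : ∀ (w : List (Fin n)) (p q : Q), w.length = k → readState step w p = readState step w q) :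
    SyncAt step k :=
  ⟨fun w => readState step w.1 (Classical.arbitrary Q), fun w _ => h _ _ _ w.2⟩

end Read

namespace Transducer

variable {n : ℕ} (T : Transducer n)

theorem readOut_prefix {k l : ℕ} (h : k ≤ l) (x : Cantor n) (q : T.Q) :
    readOut T.step T.out (pre x k) q <+: readOut T.step T.out (pre x l) q := by
  have : pre x l = pre x k ++ pre (tail k x) (l - k) := by
    apply List.ext_getElem
    · simp; omega
    · intro i h1 h2
      rw [getElem_pre, List.getElem_append]
      split_ifs with h3
      · rw [getElem_pre]
      · rw [getElem_pre, tail]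
        congr 1
        simp at h3 ⊢
        omega
  rw [this, readOut_append]
  exact List.prefix_append _ _

theorem act_mem_cone (q : T.Q) (x : Cantor n) (k : ℕ) :
    T.act q x ∈ cone (readOut T.step T.out (pre x k) q) := by
  rw [mem_cone_iff_getElem]
  intro i hi
  unfold act
  rcases le_total k (T.productive q x i).choose with h | h
  · exact ((T.readOut_prefix h x q).getElem hi).symm
  · exact (T.readOut_prefix h x q).getElem _

/-- The induced maps are the only maps that satisfy the recursion given by transitions and
outputs. -/
theorem act_eq_of_recursion {φ : T.Q → Cantor n → Cantor n}
    (hφ : ∀ i q y, φ q (app [i] y) = app (T.out i q) (φ (T.step i q) y)) (q : T.Q) :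
    T.act q = φ q := by
  funext x i
  obtain ⟨k, hk⟩ := T.productive q x i
  have h1 := mem_cone_iff_getElem.1 (T.act_mem_cone q x k) i hk
  have h2 : φ q x ∈ cone (readOut T.step T.out (pre x k) q) := by
    have := app_readOut T.step T.out hφ (pre x k) q (tail k x)
    rw [app_pre_tail] at this
    rw [this]
    exact app_mem_cone _ _
  rw [h1, mem_cone_iff_getElem.1 h2 i hk]

theorem pre_app_cons (i : Fin n) (y : Cantor n) (k : ℕ) :
    pre (app [i] y) (k + 1) = i :: pre y k := by
  apply List.ext_getElem
  · simp
  · intro j h1 h2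
    rw [getElem_pre]
    cases j with
    | zero => simp
    | succ j =>
      simp only [List.getElem_cons_succ, getElem_pre]
      exact congrFun (shift_app_cons i [] y |>.trans (app_nil y)) j

theorem act_app_singleton (i : Fin n) (q : T.Q) (y : Cantor n) :
    T.act q (app [i] y) = app (T.out i q) (T.act (T.step i q) y) := by
  funext j
  obtain ⟨k, hk⟩ := T.productive (T.step i q) y j
  have h1 := T.act_mem_cone q (app [i] y) (k + 1)
  rw [pre_app_cons, readOut] at h1
  obtain ⟨z, hz⟩ := mem_cone_iff.1 (T.act_mem_cone (T.step i q) y k)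
  rw [mem_cone_iff_getElem.1 h1 j (by simp; omega), hz, ← app_append,
    app_of_lt _ _ (by simp; omega)]

theorem act_app (w : List (Fin n)) (q : T.Q) (y : Cantor n) :
    T.act q (app w y) =
      app (readOut T.step T.out w q) (T.act (readState T.step w q) y) :=
  app_readOut T.step T.out (φ := T.act) (fun i q y => T.act_app_singleton i q y) w q y

theorem continuous_act (q : T.Q) : Continuous (T.act q) := by
  refine continuous_of_exists_pre fun x m => ?_
  obtain ⟨k, hk⟩ := T.productive q x m
  refine ⟨k, fun y hy => ?_⟩
  have h1 := T.act_mem_cone q x k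
  have h2 := T.act_mem_cone q y k
  have : pre y k = pre x k := by simpa [cone] using hy
  rw [this] at h2
  exact cone_subset_of_mem (by simpa using hk.le) (mem_cone_pre _ _) h1 h2

/-- By compactness, the length of the output grows uniformly with the length of the input. -/
theorem exists_le_length_readOut [Finite T.Q] (m : ℕ) :
    ∃ M, ∀ (q : T.Q) (w : List (Fin n)), M ≤ w.length →
      m ≤ (readOut T.step T.out w q).length := by
  rcases isEmpty_or_nonempty (Fin n) with hn | hn
  · rcases isEmpty_or_nonempty T.Q with hQ | hQ
    · exact ⟨0, fun q => hQ.elim q⟩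
    · refine ⟨1, fun q w hw => ?_⟩
      obtain _ | ⟨i, w⟩ := w
      · simp at hw
      · exact hn.elim i
  have key : ∀ q : T.Q, ∃ M, ∀ w : List (Fin n), M ≤ w.length →
      m ≤ (readOut T.step T.out w q).length := by
    intro q
    have hopen : ∀ k, IsOpen {x : Cantor n | m < (readOut T.step T.out (pre x k) q).length} := by
      intro k
      rw [isOpen_iff_mem_nhds]
      intro x hx
      filter_upwards [(isOpen_cone (pre x k)).mem_nhds (mem_cone_pre _ _)] with y hy
      have : pre y k = pre x k := by simpa [cone] using hy
      simpa [this] using hx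
    obtain ⟨M, hM⟩ := isCompact_univ.elim_directed_cover _ hopen
      (fun x _ => by simpa using T.productive q x m)
      (directed_of_isDirected_le fun k l hkl x hx =>
        lt_of_lt_of_le hx (T.readOut_prefix hkl x q).length_le)
    refine ⟨M, fun w hw => ?_⟩
    let x : Cantor n := app w fun _ => hn.some
    have h1 : m < (readOut T.step T.out (pre x M) q).length := hM (Set.mem_univ x)
    have h2 := (T.readOut_prefix hw x q).length_le
    have h3 : pre x w.length = w := pre_app _ _
    rw [h3] at h2
    omega
  choose M hM using key
  obtain ⟨N, hN⟩ := (Set.finite_range M).bddAbove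
  exact ⟨N, fun q w hw => hM q w ((hN ⟨q, rfl⟩).trans hw)⟩

variable {T} {U : Transducer n}

theorem Iso.readState_eq (e : T.Iso U) (w : List (Fin n)) (q : T.Q) :
    e.toEquiv (readState T.step w q) = readState U.step w (e.toEquiv q) := by
  induction w generalizing q with
  | nil => rfl
  | cons i w ih => rw [readState, ih, e.map_step, readState]

theorem Iso.act_eq (e : T.Iso U) (q : T.Q) : T.act q = U.act (e.toEquiv q) :=
  T.act_eq_of_recursion (φ := fun q => U.act (e.toEquiv q))
    (fun i q y => by rw [U.act_app_singleton, e.map_out, e.map_step]) q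

end Transducer

/-! ### Maps that act locally by the states of a transducer -/

namespace Transducer

variable {n r : ℕ}

/-- The map `g` acts locally by the states of `T` at level `K`: every word `w` of length `K`
forces a state `q` of `T`, and on each cone `ȧ U_w` the map `g` is `h_q` up to an exchange of
prefixes, i.e. `ȧ w x ↦ ḃ u h_q(x)`. -/
def LocallyActs (T : Transducer n) (g : CantorR n r → CantorR n r) (K : ℕ) : Prop :=
  ∀ (a : Fin r) (w : List (Fin n)), w.length = K → ∃ (q : T.Q) (b : Fin r) (u : List (Fin n)),
    (∀ p, readState T.step w p = q) ∧ ∀ x, g (a, app w x) = (b, app u (T.act q x))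

namespace LocallyActs

variable {T : Transducer n} {g : CantorR n r → CantorR n r} {K : ℕ}

theorem syncAt (h : T.LocallyActs g K) (a : Fin r) : SyncAt T.step K := by
  choose s _ _ hs _ using fun w : List.Vector (Fin n) K => h a w.1 w.2
  exact ⟨s, hs⟩

/-- Longer prefixes act locally as well, and the output on them is as long as desired. -/
theorem exists_long [Finite T.Q] (h : T.LocallyActs g K) (m : ℕ) :
    ∃ M, K ≤ M ∧ ∀ (a : Fin r) (w : List (Fin n)), M ≤ w.length →
      ∃ (q : T.Q) (b : Fin r) (u : List (Fin n)), m ≤ u.length ∧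
        (∀ p, readState T.step w p = q) ∧ ∀ x, g (a, app w x) = (b, app u (T.act q x)) := by
  obtain ⟨M, hM⟩ := T.exists_le_length_readOut m
  refine ⟨K + M, Nat.le_add_right _ _, fun a w hw => ?_⟩
  obtain ⟨q, b, u, hq, hu⟩ := h a (w.take K) (by simp; omega)
  refine ⟨readState T.step (w.drop K) q, b, u ++ readOut T.step T.out (w.drop K) q, ?_, ?_, ?_⟩
  · have := hM q (w.drop K) (by simp; omega)
    simp only [List.length_append]
    omega
  · intro p
    conv_lhs => rw [← List.take_append_drop K w]
    rw [readState_append, hq]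
  · intro x
    conv_lhs => rw [← List.take_append_drop K w]
    rw [app_append, hu, act_app, app_append]

theorem of_le [Finite T.Q] (h : T.LocallyActs g K) {a : Fin r} {w : List (Fin n)}
    (hw : K ≤ w.length) : ∃ (q : T.Q) (b : Fin r) (u : List (Fin n)),
      (∀ p, readState T.step w p = q) ∧ ∀ x, g (a, app w x) = (b, app u (T.act q x)) := by
  obtain ⟨q, b, u, hq, hu⟩ := h a (w.take K) (by simpa using hw)
  refine ⟨readState T.step (w.drop K) q, b, u ++ readOut T.step T.out (w.drop K) q, ?_, ?_⟩
  · intro p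
    conv_lhs => rw [← List.take_append_drop K w]
    rw [readState_append, hq]
  · intro x
    conv_lhs => rw [← List.take_append_drop K w]
    rw [app_append, hu, act_app, app_append]

theorem mono [Finite T.Q] (h : T.LocallyActs g K) {L : ℕ} (hL : K ≤ L) : T.LocallyActs g L :=
  fun _ _ hw => h.of_le (hL.trans hw.ge)

theorem continuous (h : T.LocallyActs g K) : Continuous g := by
  rw [continuous_iff_continuousAt]
  rintro ⟨a, x⟩
  obtain ⟨q, b, u, -, hu⟩ := h a (pre x K) (by simp)
  have hc : Continuous fun z : CantorR n r => (b, app u (T.act q (tail K z.2))) :=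
    continuous_const.prodMk ((continuous_app u).comp
      ((T.continuous_act q).comp ((continuous_tail K).comp continuous_snd)))
  refine hc.continuousAt.congr ?_
  have hnhds : ({a} : Set (Fin r)) ×ˢ cone (pre x K) ∈ nhds (a, x) :=
    ((isOpen_discrete _).prod (isOpen_cone _)).mem_nhds ⟨rfl, mem_cone_pre _ _⟩
  filter_upwards [hnhds] with z hz
  obtain ⟨a', y⟩ := z
  obtain ⟨h1, h2⟩ := hz
  obtain rfl : a' = a := h1
  have : pre y K = pre x K := by simpa [cone] using h2
  rw [← hu, ← this, app_pre_tail]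

end LocallyActs

end Transducer

namespace TransducerR

variable {n r : ℕ} {A : TransducerR n r}

theorem Emits.nonempty_base {m : A.Move} {x : Cantor n} {z : CantorR n r} (h : A.Emits m x z) :
    Nonempty A.base.Q := by
  induction h with
  | leave s => exact ⟨s⟩
  | stay _ _ _ _ ih => exact ih

theorem readState_step_inr (w : List (Fin n)) (s : A.base.Q) :
    readState A.step w (Sum.inr s) = Sum.inr (readState A.base.step w s) := by
  induction w generalizing s with
  | nil => rfl
  | cons i w ih => exact ih _

theorem Emits.eq_of_readState {m : A.Move} {w : List (Fin n)} {s : A.base.Q}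
    (hs : readState A.step w (A.target m) = Sum.inr s) :
    ∃ (b : Fin r) (u : List (Fin n)), ∀ x z, A.Emits m (app w x) z →
      z = (b, app u (A.base.act s x)) := by
  induction w generalizing m with
  | nil =>
    obtain q | ⟨s', b, v⟩ := m
    · simp [target, readState] at hs
    · obtain rfl : s' = s := by simpa [target, readState] using hs
      refine ⟨b, v, fun x z h => ?_⟩
      cases h
      simp
  | cons i w ih =>
    obtain q | ⟨s', b, v⟩ := m
    · obtain ⟨b, u, hu⟩ := ih (m := A.stepR i q) hs
      refine ⟨b, u, fun x z h => ?_⟩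
      cases h with
      | stay _ _ _ h =>
        rw [app_cons_zero, shift_app_cons] at h
        exact hu x z h
    · have h1 : readState A.base.step (i :: w) s' = s := by
        have := readState_step_inr (A := A) (i :: w) s'
        exact Sum.inr_injective (this.symm.trans hs)
      refine ⟨b, v ++ readOut A.base.step A.base.out (i :: w) s', fun x z h => ?_⟩
      cases h
      rw [Transducer.act_app, h1, app_append]

theorem syncAt_readState_eq_inr {k : ℕ} (h : SyncAt A.step k) (hQ : Nonempty A.base.Q)
    {w : List (Fin n)} (hw : k ≤ w.length) :
    ∃ s, ∀ p, readState A.step w p = Sum.inr s := by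
  obtain ⟨s0⟩ := hQ
  exact ⟨readState A.base.step w s0, fun p => by
    rw [h.readState_eq hw p (Sum.inr s0), readState_step_inr]⟩

/-- A synchronizing transducer induces a map that acts locally by its states. -/
theorem Represents.exists_forced {g : CantorR n r → CantorR n r} (hA : A.Represents g) {k : ℕ}
    (hk : SyncAt A.step k) (hn : 0 < n) (a : Fin r) {w : List (Fin n)} (hw : k ≤ w.length) :
    ∃ (s : A.base.Q) (b : Fin r) (u : List (Fin n)),
      (∀ p, readState A.step w p = Sum.inr s) ∧
        ∀ x, g (a, app w x) = (b, app u (A.base.act s x)) := by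
  obtain ⟨s, hs⟩ := syncAt_readState_eq_inr hk (hA a fun _ => ⟨0, hn⟩).nonempty_base hw
  obtain ⟨b, u, hu⟩ := Emits.eq_of_readState (hs (A.target (A.init a)))
  exact ⟨s, b, u, hs, fun x => hu x _ (hA a (app w x))⟩

theorem Represents.locallyActs {g : CantorR n r → CantorR n r} (hA : A.Represents g) {k : ℕ}
    (hk : SyncAt A.step k) (hn : 0 < n) : A.base.LocallyActs g k := by
  intro a w hw
  obtain ⟨s, b, u, hs, hu⟩ := hA.exists_forced hk hn a hw.ge
  exact ⟨s, b, u, fun p => Sum.inr_injective ((readState_step_inr w p).symm.trans (hs _)), hu⟩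

theorem act_core (s : A.core.Q) : A.core.act s = A.base.act s.1 :=
  A.core.act_eq_of_recursion (φ := fun s => A.base.act s.1)
    (fun i q y => A.base.act_app_singleton i q.1 y) s

theorem readState_core (w : List (Fin n)) (s : A.core.Q) :
    (readState A.core.step w s).1 = readState A.base.step w s.1 := by
  induction w generalizing s with
  | nil => rfl
  | cons i w ih => exact ih _

end TransducerR

/-- The properties that characterize, for a homeomorphism `h` in `B_{n,r}`, the transducers that
are isomorphic to the core of its minimal transducer: `T` is finite, its states are pairwise
inequivalent and forced by words, the outputs of a state do not all begin with the same letter, and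
`h` acts locally by the states of `T`. -/
structure IsCoreOf {n r : ℕ} (T : Transducer n) (h : CantorR n r ≃ₜ CantorR n r) (K : ℕ) :
    Prop where
  finite : Finite T.Q
  exists_ne : ∀ (q : T.Q) (i : Fin n), ∃ y, T.act q y 0 ≠ i
  reduced : ∀ q q' : T.Q, T.act q = T.act q' → q = q'
  exists_forced : ∀ q : T.Q, ∃ w : List (Fin n), w.length = K ∧ ∀ p, readState T.step w p = q
  locallyActs : T.LocallyActs h K

/-- The inverse of `h` is induced by a finite synchronizing transducer, and thus acts locally by
the states of a finite transducer. -/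
def HasSyncInverse {n r : ℕ} (h : CantorR n r ≃ₜ CantorR n r) : Prop :=
  ∃ (U : Transducer n) (K : ℕ), Finite U.Q ∧ U.LocallyActs h.symm K

theorem IsBiSync.hasSyncInverse {n r : ℕ} (hn : 0 < n) {A : TransducerR n r}
    {h : CantorR n r ≃ₜ CantorR n r} (hA : IsBiSync A h) : HasSyncInverse h := by
  obtain ⟨B, hfin, hrep, k, hk⟩ := hA.sync_inv
  have : Finite (B.R ⊕ B.base.Q) := hfin
  exact ⟨B.base, k, Finite.of_injective (Sum.inr : _ → B.R ⊕ B.base.Q) Sum.inr_injective,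
    hrep.locallyActs hk hn⟩

theorem IsBiSync.exists_isCoreOf {n r : ℕ} (hn : 2 ≤ n) {A : TransducerR n r}
    {h : CantorR n r ≃ₜ CantorR n r} (hA : IsBiSync A h) {T : Transducer n} (e : T.Iso A.core) :
    ∃ K, IsCoreOf T h K := by
  have hn0 : 0 < n := by omega
  have : Finite (A.R ⊕ A.base.Q) := hA.finite
  have hfin : Finite A.base.Q :=
    Finite.of_injective (Sum.inr : _ → A.R ⊕ A.base.Q) Sum.inr_injective
  obtain ⟨k, hk⟩ := hA.sync
  have hact : ∀ q : T.Q, T.act q = A.base.act (e.toEquiv q).1 := fun q => by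
    rw [e.act_eq, TransducerR.act_core]
  have hread : ∀ (w : List (Fin n)) (q : T.Q),
      (e.toEquiv (readState T.step w q)).1 = readState A.base.step w (e.toEquiv q).1 := fun w q => by
    rw [e.readState_eq, TransducerR.readState_core]
  have hinj : ∀ q q' : T.Q, (e.toEquiv q).1 = (e.toEquiv q').1 → q = q' := fun q q' h =>
    e.toEquiv.injective (Subtype.ext h)
  -- Words that force a state of `A` force the corresponding state of `T`.
  have hforced : ∀ (w : List (Fin n)) (q : T.Q),
      (∀ p, readState A.step w p = Sum.inr (e.toEquiv q).1) → ∀ p, readState T.step w p = q := by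
    intro w q hw p
    apply hinj
    rw [hread]
    exact Sum.inr_injective ((TransducerR.readState_step_inr w _).symm.trans (hw _))
  -- Every state of the core is forced by a word of length `l`, for every `l ≥ k`.
  have hcore : ∀ s ∈ A.coreStates, ∀ l, k ≤ l → ∃ w : List (Fin n), w.length = l ∧
      ∀ p, readState A.step w p = Sum.inr s := by
    rintro s ⟨k', hk', w, hw⟩ l hl
    rcases le_total k' l with hle | hle
    · refine ⟨List.replicate (l - k') ⟨0, hn0⟩ ++ w.1, by simp [hle], fun p => ?_⟩
      rw [readState_append, hw]
    · refine ⟨w.1.drop (k' - l), by simp; omega, fun p => ?_⟩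
      rw [← hw p]
      conv_rhs => rw [← List.take_append_drop (k' - l) w.1, readState_append]
      exact hk.readState_eq (by simp; omega) _ _
  refine ⟨k, ⟨?_, ?_, ?_, ?_, ?_⟩⟩
  · have : Finite A.core.Q := Subtype.finite (p := fun s => s ∈ A.coreStates)
    exact Finite.of_equiv _ e.toEquiv.symm
  · intro q i
    obtain ⟨w, hwl, hw⟩ := hcore _ (e.toEquiv q).2 (k + 1) (Nat.le_succ k)
    -- `q` is entered by a transition, whose output is a greatest common prefix.
    obtain ⟨v, j, rfl⟩ : ∃ v j, w = v ++ [j] := by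
      rcases List.eq_nil_or_concat w with rfl | ⟨v, j, rfl⟩
      · simp at hwl
      · exact ⟨v, j, by simp⟩
    set s := readState A.base.step v (e.toEquiv q).1 with hs
    have hstep : A.base.step j s = (e.toEquiv q).1 := by
      have := hw (Sum.inr (e.toEquiv q).1)
      rw [TransducerR.readState_step_inr] at this
      have := Sum.inr_injective this
      rwa [readState_append] at this
    by_contra hcon
    push Not at hcon
    have h1 := (hA.minimal.complete_S j s).2 (A.base.out j s ++ [i]) ?_
    · simp at h1
    · rintro z ⟨x, hx, rfl⟩
      rw [← app_zero_shift x, hx, Transducer.act_app_singleton, hstep, ← hact]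
      rw [← app_zero_shift (T.act q (shift x)), hcon, ← app_append]
      exact app_mem_cone _ _
  · intro q q' hqq
    rw [hact, hact] at hqq
    exact hinj _ _ (hA.minimal.reduced_S _ _ hqq)
  · intro q
    obtain ⟨w, hwl, hw⟩ := hcore _ (e.toEquiv q).2 k le_rfl
    exact ⟨w, hwl, hforced w q hw⟩
  · intro a w hw
    obtain ⟨s, b, u, hs, hu⟩ := hA.represents.exists_forced hk hn0 a hw.ge
    have hmem : s ∈ A.coreStates := ⟨k, hk, ⟨w, hw⟩, hs⟩
    have hq : (e.toEquiv (e.toEquiv.symm ⟨s, hmem⟩)).1 = s :=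
      congrArg Subtype.val (e.toEquiv.apply_symm_apply _)
    refine ⟨e.toEquiv.symm ⟨s, hmem⟩, b, u, hforced w _ (by rwa [hq]), fun x => ?_⟩
    rw [hu, hact, hq]


/-! ### The minimal transducer of a homeomorphism -/

section Minimal

variable {n r : ℕ}

/-- An injective map splits off the greatest common prefix `u` of its values. -/
theorem exists_eq_app_of_injective (hn : 2 ≤ n) {F : Cantor n → Cantor n}
    (hF : Function.Injective F) :
    ∃ (f : Cantor n → Cantor n) (u : List (Fin n)),
      (∀ y, F y = app u (f y)) ∧ ∀ i, ∃ y, f y 0 ≠ i := by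
  have hne : F (fun _ => ⟨0, by omega⟩) ≠ F (fun _ => ⟨1, by omega⟩) := fun h => by
    simpa using congrFun (hF h) 0
  obtain ⟨j, hj⟩ := Function.ne_iff.1 hne
  obtain ⟨u, hu, hmax⟩ : ∃ u : List (Fin n), (∀ y, F y ∈ cone u) ∧
      ∀ i, ¬ ∀ y, F y ∈ cone (u ++ [i]) := by
    by_contra! hcon
    have : ∀ m, ∃ u : List (Fin n), u.length = m ∧ ∀ y, F y ∈ cone u := by
      intro m
      induction m with
      | zero => exact ⟨[], rfl, fun y => by simp [cone, pre]⟩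
      | succ m ih =>
        obtain ⟨u, rfl, hu⟩ := ih
        obtain ⟨i, hi⟩ := hcon u hu
        exact ⟨u ++ [i], by simp, hi⟩
    obtain ⟨u, hu, hy⟩ := this (j + 1)
    exact hj ((mem_cone_iff_getElem.1 (hy _) j (by omega)).trans
      (mem_cone_iff_getElem.1 (hy _) j (by omega)).symm)
  choose f hf using fun y => mem_cone_iff.1 (hu y)
  refine ⟨f, u, hf, fun i => ?_⟩
  by_contra! hcon
  refine hmax i fun y => ?_
  rw [hf, ← app_zero_shift (f y), hcon, ← app_append]
  exact app_mem_cone _ _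

theorem length_le_of_app_eq_app {f f' : Cantor n → Cantor n} {u u' : List (Fin n)}
    (hf : ∀ i, ∃ y, f y 0 ≠ i) (h : ∀ y, app u (f y) = app u' (f' y)) : u'.length ≤ u.length := by
  by_contra! hlt
  obtain ⟨y, hy⟩ := hf u'[u.length]
  apply hy
  rw [← app_length_add u (f y) 0, h]
  exact app_of_lt u' (f' y) hlt

theorem eq_of_app_eq_app {f f' : Cantor n → Cantor n} {u u' : List (Fin n)}
    (hf : ∀ i, ∃ y, f y 0 ≠ i) (hf' : ∀ i, ∃ y, f' y 0 ≠ i)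
    (h : ∀ y, app u (f y) = app u' (f' y)) : f = f' := by
  have hle := le_antisymm (length_le_of_app_eq_app hf' fun y => (h y).symm)
    (length_le_of_app_eq_app hf h)
  exact funext fun y => (app_eq_app_of_length hle (h y)).2

/-- The maps for which the minimal transducer is constructed. -/
structure Admissible (g : CantorR n r → CantorR n r) : Prop where
  two_le : 2 ≤ n
  injective : Function.Injective g
  continuous : Continuous g
  exists_level : ∃ K, ∀ (a : Fin r) (w : List (Fin n)), K ≤ w.length →
    ∃ b, ∀ x, (g (a, app w x)).1 = b

/-- The residual maps `y ↦ g(ȧ w y)` of `g` whose values do not all lie in one copy of Cantor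
space: the states of the minimal transducer that are reached without output. -/
def RState (g : CantorR n r → CantorR n r) : Type :=
  {f : Cantor n → CantorR n r //
    (∃ a w, f = fun y => g (a, app w y)) ∧ ∀ b, ∃ y, (f y).1 ≠ b}

/-- The residual maps of `g` with output: `f` such that `g(ȧ w y) = ḃ u f(y)`, where `ḃ u` is the
greatest common prefix of all `g(ȧ w y)`. These are the states of the minimal transducer that are
reached after some output. -/
def SState (g : CantorR n r → CantorR n r) : Type :=
  {f : Cantor n → Cantor n //
    (∃ a w b u, ∀ y, g (a, app w y) = (b, app u (f y))) ∧ ∀ i, ∃ y, f y 0 ≠ i}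

/-- The move `m` (a state together with an output on the way to it) accounts for the map `F`. -/
def Denotes {g : CantorR n r → CantorR n r} :
    RState g ⊕ (SState g × Fin r × List (Fin n)) → (Cantor n → CantorR n r) → Prop
  | Sum.inl f, F => f.1 = F
  | Sum.inr (f, b, u), F => ∀ y, F y = (b, app u (f.1 y))

/-- The state `p` is the residual of `g` at the prefix `ȧ w`. -/
def IsResidual {g : CantorR n r → CantorR n r} (a : Fin r) (w : List (Fin n)) :
    RState g ⊕ SState g → Prop
  | Sum.inl f => f.1 = fun y => g (a, app w y)
  | Sum.inr f => ∃ b u, ∀ y, g (a, app w y) = (b, app u (f.1 y))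

theorem IsResidual.unique {g : CantorR n r → CantorR n r} {a : Fin r} {w : List (Fin n)}
    {p p' : RState g ⊕ SState g} (hp : IsResidual a w p) (hp' : IsResidual a w p') : p = p' := by
  have aux : ∀ (f : RState g) (f' : SState g), IsResidual a w (Sum.inl f) →
      ¬ IsResidual a w (Sum.inr f') := by
    rintro ⟨f, hf, hf2⟩ f' h ⟨b, u, h'⟩
    obtain ⟨y, hy⟩ := hf2 b
    exact hy (congrArg Prod.fst ((congrFun h y).trans (h' y)))
  obtain f | f := p <;> obtain f' | f' := p'
  · exact congrArg Sum.inl (Subtype.ext (hp.trans hp'.symm))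
  · exact (aux _ _ hp hp').elim
  · exact (aux _ _ hp' hp).elim
  · obtain ⟨b, u, h⟩ := hp
    obtain ⟨b', u', h'⟩ := hp'
    refine congrArg Sum.inr (Subtype.ext (eq_of_app_eq_app (u := u) (u' := u') f.2.2 f'.2.2 ?_))
    intro y
    have := (h y).symm.trans (h' y)
    exact (Prod.ext_iff.1 this).2

namespace Admissible

variable {g : CantorR n r → CantorR n r}

theorem exists_denotes (H : Admissible g) (a : Fin r) (w : List (Fin n)) :
    ∃ m : RState g ⊕ (SState g × Fin r × List (Fin n)), Denotes m fun y => g (a, app w y) := by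
  by_cases h : ∀ b, ∃ y, (g (a, app w y)).1 ≠ b
  · exact ⟨Sum.inl ⟨_, ⟨a, w, rfl⟩, h⟩, rfl⟩
  · push Not at h
    obtain ⟨b, hb⟩ := h
    have hinj : Function.Injective fun y => (g (a, app w y)).2 := fun y y' hy =>
      app_injective w (Prod.ext_iff.1 (H.injective
        (Prod.ext ((hb y).trans (hb y').symm) hy : g (a, app w y) = g (a, app w y')))).2
    obtain ⟨f, u, hu, hf⟩ := exists_eq_app_of_injective H.two_le hinj
    have h2 : ∀ y, g (a, app w y) = (b, app u (f y)) := fun y => Prod.ext (hb y) (hu y)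
    exact ⟨Sum.inr (⟨f, ⟨a, w, b, u, h2⟩, hf⟩, b, u), h2⟩

theorem exists_denotes_RState (H : Admissible g) (i : Fin n) (f : RState g) :
    ∃ m : RState g ⊕ (SState g × Fin r × List (Fin n)), Denotes m fun y => f.1 (app [i] y) := by
  obtain ⟨f, ⟨a, w, rfl⟩, hf⟩ := f
  obtain ⟨m, hm⟩ := H.exists_denotes a (w ++ [i])
  simp only [app_append] at hm
  exact ⟨m, hm⟩

theorem exists_step_SState (H : Admissible g) (i : Fin n) (f : SState g) :
    ∃ p : SState g × List (Fin n), ∀ y, f.1 (app [i] y) = app p.2 (p.1.1 y) := by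
  obtain ⟨f, ⟨a, w, b, u, hu⟩, hf⟩ := f
  have hinj : Function.Injective fun y => f (app [i] y) := fun y y' hy => by
    have h1 : g (a, app w (app [i] y)) = g (a, app w (app [i] y')) := by
      rw [hu, hu]
      exact congrArg (fun z => (b, app u z)) hy
    exact app_injective [i] (app_injective w (Prod.ext_iff.1 (H.injective h1)).2)
  obtain ⟨f', v, hv, hf'⟩ := exists_eq_app_of_injective H.two_le hinj
  refine ⟨(⟨f', ⟨a, w ++ [i], b, u ++ v, fun y => ?_⟩, hf'⟩, v), hv⟩
  rw [app_append, hu, app_append]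
  exact congrArg (fun z => (b, app u z)) (hv y)

/-- The transitions of the minimal transducer after some output. -/
noncomputable def stepS (H : Admissible g) (i : Fin n) (f : SState g) : SState g :=
  (H.exists_step_SState i f).choose.1

/-- The outputs of the minimal transducer after some output. -/
noncomputable def outS (H : Admissible g) (i : Fin n) (f : SState g) : List (Fin n) :=
  (H.exists_step_SState i f).choose.2

theorem stepS_spec (H : Admissible g) (i : Fin n) (f : SState g) (y : Cantor n) :
    f.1 (app [i] y) = app (H.outS i f) ((H.stepS i f).1 y) :=
  (H.exists_step_SState i f).choose_spec y

/-- The moves of the minimal transducer from the initial state. -/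
noncomputable def initMove (H : Admissible g) (a : Fin r) :
    RState g ⊕ (SState g × Fin r × List (Fin n)) :=
  (H.exists_denotes a []).choose

theorem initMove_spec (H : Admissible g) (a : Fin r) :
    Denotes (H.initMove a) fun y => g (a, y) := by
  have : Denotes (H.initMove a) fun y => g (a, app [] y) := (H.exists_denotes a []).choose_spec
  simpa only [app_nil] using this

/-- The moves of the minimal transducer before any output. -/
noncomputable def stepR (H : Admissible g) (i : Fin n) (f : RState g) :
    RState g ⊕ (SState g × Fin r × List (Fin n)) :=
  (H.exists_denotes_RState i f).choose

theorem stepR_spec (H : Admissible g) (i : Fin n) (f : RState g) :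
    Denotes (H.stepR i f) fun y => f.1 (app [i] y) :=
  (H.exists_denotes_RState i f).choose_spec

theorem continuous_SState (H : Admissible g) (f : SState g) : Continuous f.1 := by
  obtain ⟨f, ⟨a, w, b, u, hu⟩, hf⟩ := f
  have : f = fun y => tail u.length (g (a, app w y)).2 := by
    funext y
    rw [hu, tail_app]
  show Continuous f
  rw [this]
  exact (continuous_tail _).comp (continuous_snd.comp (H.continuous.comp
    (continuous_const.prodMk (continuous_app w))))

/-- After some output, the minimal transducer is a transducer over `X_n`. -/
noncomputable def base (H : Admissible g) : Transducer n where
  Q := SState g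
  step := H.stepS
  out := H.outS
  productive f x m := by
    obtain ⟨k, hk⟩ := exists_pre_mapsTo_cone (H.continuous_SState f) x (m + 1)
    refine ⟨k, ?_⟩
    -- Otherwise the letters at position `|o|` of all outputs agree, for the output `o` on `pre x k`.
    by_contra! hle
    set o := readOut H.stepS H.outS (pre x k) f with ho
    obtain ⟨y, hy⟩ := (readState H.stepS (pre x k) f).2.2 (f.1 x o.length)
    apply hy
    have h1 := mem_cone_iff_getElem.1 (hk _ (app_mem_cone (pre x k) y)) o.length
      (by simp; omega)
    rw [getElem_pre, app_readOut H.stepS H.outS (φ := fun f => f.1)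
      (fun i q y => H.stepS_spec i q y)] at h1
    rw [← h1]
    exact (app_length_add o _ 0).symm

theorem act_base (H : Admissible g) (f : SState g) : H.base.act f = f.1 :=
  H.base.act_eq_of_recursion (φ := fun f => f.1) (fun i q y => H.stepS_spec i q y) f

theorem isResidual_of_denotes {m : RState g ⊕ (SState g × Fin r × List (Fin n))} {a : Fin r}
    {w : List (Fin n)} (h : Denotes m fun y => g (a, app w y)) :
    IsResidual a w (Sum.map id Prod.fst m) := by
  obtain f | ⟨f, b, u⟩ := m
  · exact h
  · exact ⟨b, u, h⟩

theorem isResidual_readState (H : Admissible g) {a : Fin r} {w : List (Fin n)}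
    {p : RState g ⊕ SState g} (hp : IsResidual a w p) (v : List (Fin n)) :
    IsResidual a (w ++ v) (readState (stepSum H.stepR H.stepS) v p) := by
  induction v generalizing w p with
  | nil => simpa [readState] using hp
  | cons i v ih =>
    have key : IsResidual a (w ++ [i]) (stepSum H.stepR H.stepS i p) := by
      obtain f | f := p
      · apply isResidual_of_denotes
        have h1 := H.stepR_spec i f
        rw [show f.1 = _ from hp] at h1
        simpa only [app_append] using h1
      · obtain ⟨b, u, hu⟩ := hp
        refine ⟨b, u ++ H.outS i f, fun y => ?_⟩
        rw [app_append, hu, H.stepS_spec, app_append]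
    have := ih key
    rwa [List.append_assoc] at this

theorem exists_length_lt (H : Admissible g) : ∃ K, ∀ (a : Fin r) (w : List (Fin n)) (f : RState g),
    IsResidual a w (Sum.inl f) → w.length < K := by
  obtain ⟨K, hK⟩ := H.exists_level
  refine ⟨K, fun a w f h => ?_⟩
  by_contra! hle
  obtain ⟨b, hb⟩ := hK a w hle
  obtain ⟨y, hy⟩ := f.2.2 b
  exact hy ((congrArg Prod.fst (congrFun h y)).trans (hb y))

/-- The minimal transducer of `g`, whose states are the residual maps of `g`. -/
noncomputable def minimal (H : Admissible g) : TransducerR n r where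
  R := RState g
  finite_R := by
    obtain ⟨K, hK⟩ := H.exists_length_lt
    have hfin : Finite {p : Fin r × List (Fin n) | p.2.length < K} := by
      exact ((Set.finite_univ (α := Fin r)).prod (List.finite_length_lt (Fin n) K)).subset
        fun p hp => ⟨trivial, hp⟩
    choose a w h using fun f : RState g => f.2.1
    refine Finite.of_injective
      (fun f => (⟨(a f, w f), hK _ _ f (h f)⟩ : {p : Fin r × List (Fin n) | p.2.length < K})) ?_
    intro f f' hff
    have h1 : a f = a f' ∧ w f = w f' := by simpa using hff
    exact Subtype.ext ((h f).trans (by rw [h f', h1.1, h1.2]))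
  base := H.base
  init := H.initMove
  stepR := H.stepR
  acyclic w f hw hcyc := by
    obtain ⟨K, hK⟩ := H.exists_length_lt
    -- Going round the cycle makes `f` a residual at arbitrarily long prefixes.
    have : ∀ l, ∃ (a : Fin r) (v : List (Fin n)), l ≤ v.length ∧ IsResidual a v (Sum.inl f) := by
      intro l
      induction l with
      | zero =>
        obtain ⟨a, v, h⟩ := f.2.1
        exact ⟨a, v, Nat.zero_le _, h⟩
      | succ l ih =>
        obtain ⟨a, v, hl, h⟩ := ih
        have h1 := H.isResidual_readState h w
        have h2 : readState (stepSum H.stepR H.stepS) w (Sum.inl f) = Sum.inl f := hcyc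
        rw [h2] at h1
        have := List.length_pos_iff.2 hw
        exact ⟨a, v ++ w, by simp; omega, h1⟩
    obtain ⟨a, v, hl, h⟩ := this K
    exact absurd (hK a v f h) (by omega)

theorem isResidual_init (H : Admissible g) (a : Fin r) (w : List (Fin n)) :
    IsResidual a w (readState H.minimal.step w (H.minimal.target (H.minimal.init a))) := by
  have h1 : IsResidual a [] (H.minimal.target (H.minimal.init a)) := by
    have h2 := H.initMove_spec a
    refine isResidual_of_denotes (m := H.initMove a) ?_
    simpa only [app_nil] using h2
  exact H.isResidual_readState h1 w

theorem accessible (H : Admissible g) (p : RState g ⊕ SState g) :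
    ∃ (a : Fin r) (w : List (Fin n)),
      readState H.minimal.step w (H.minimal.target (H.minimal.init a)) = p := by
  have : ∃ (a : Fin r) (w : List (Fin n)), IsResidual a w p := by
    obtain f | f := p
    · exact f.2.1
    · exact f.2.1
  obtain ⟨a, w, h⟩ := this
  exact ⟨a, w, (H.isResidual_init a w).unique h⟩

theorem eq_of_emits (H : Admissible g) {m : H.minimal.Move} {x : Cantor n} {z : CantorR n r}
    (h : H.minimal.Emits m x z) {F : Cantor n → CantorR n r} (hF : Denotes m F) : z = F x := by
  induction h generalizing F with
  | leave s b w x =>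
    rw [hF x]
    exact congrArg (fun f : Cantor n → Cantor n => (b, app w (f x))) (H.act_base s)
  | stay f x z _ ih =>
    rw [ih (H.stepR_spec (x 0) f), app_zero_shift]
    exact congrFun hF x

theorem emits (H : Admissible g) (a : Fin r) (w : List (Fin n)) (m : H.minimal.Move)
    (hm : Denotes m fun y => g (a, app w y)) (x : Cantor n) :
    H.minimal.Emits m x (g (a, app w x)) := by
  obtain ⟨K, hK⟩ := H.exists_length_lt
  induction hd : K - w.length using Nat.strong_induction_on generalizing w m x with
  | _ d ih =>
    obtain f | ⟨f, b, u⟩ := m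
    · have hlt := hK a w f hm
      refine TransducerR.Emits.stay _ _ _ ?_
      have h1 := H.stepR_spec (x 0) f
      rw [show f.1 = _ from hm] at h1
      have h2 := ih (K - (w ++ [x 0]).length) (by simp; omega) (w ++ [x 0]) (H.stepR (x 0) f)
        (by simpa only [app_append] using h1) (shift x) rfl
      rwa [app_append, app_zero_shift] at h2
    · have h1 := TransducerR.Emits.leave (A := H.minimal) f b u x
      have h2 : (b, app u (H.minimal.base.act f x)) = g (a, app w x) :=
        (congrArg (fun F : Cantor n → Cantor n => (b, app u (F x))) (H.act_base f)).trans (hm x).symm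
      rwa [h2] at h1

theorem represents (H : Admissible g) : H.minimal.Represents g := fun a x => by
  have := H.emits a [] (H.initMove a) (by simpa only [app_nil] using H.initMove_spec a) x
  rwa [app_nil] at this

/-- The output of a move is the greatest common prefix of all outputs that begin with this move. -/
theorem isGCPR_output (H : Admissible g) {m : H.minimal.Move} {F : Cantor n → CantorR n r}
    (hm : Denotes m F) (hF : ∀ x, H.minimal.Emits m x (F x)) :
    IsGCPR (H.minimal.output m) {z | ∃ x, H.minimal.Emits m x z} := by
  obtain f | ⟨f, b, u⟩ := m
  · refine ⟨fun _ _ => trivial, fun v hv => ?_⟩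
    obtain _ | ⟨b, v⟩ := v
    · exact le_rfl
    · obtain ⟨y, hy⟩ := f.2.2 b
      refine absurd (hv ⟨y, hF y⟩).1 ?_
      rwa [← show f.1 = F from hm]
  · constructor
    · rintro z ⟨x, hx⟩
      rw [H.eq_of_emits hx hm, hm x]
      exact ⟨rfl, app_mem_cone _ _⟩
    · intro v hv
      obtain _ | ⟨b', v⟩ := v
      · exact Nat.zero_le _
      · have hmem : ∀ y, app u (f.1 y) ∈ cone v := fun y => by
          have := (hv ⟨y, hF y⟩).2
          rwa [hm y] at this
        choose f' hf' using fun y => mem_cone_iff.1 (hmem y)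
        exact Nat.succ_le_succ (length_le_of_app_eq_app f.2.2 hf')

theorem isMinimal (H : Admissible g) : H.minimal.IsMinimal where
  accessible := H.accessible
  complete_init a := H.isGCPR_output (H.initMove_spec a) (H.represents a)
  complete_R i f := by
    refine H.isGCPR_output (H.stepR_spec i f) fun x => ?_
    obtain ⟨f, ⟨a, w, rfl⟩, hf⟩ := f
    have h := H.stepR_spec i ⟨_, ⟨a, w, rfl⟩, hf⟩
    have := H.emits a (w ++ [i]) _ (by simpa only [app_append] using h) x
    rwa [app_append] at this
  complete_S i f := by
    constructor
    · rintro z ⟨x, hx, rfl⟩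
      rw [← app_zero_shift x, hx, Transducer.act_app_singleton]
      exact app_mem_cone _ _
    · intro v hv
      have hmem : ∀ y, app (H.outS i f) ((H.stepS i f).1 y) ∈ cone v := fun y =>
        hv ⟨app [i] y, app_cons_zero _ _ _,
          (congrFun (H.act_base f) _).trans (H.stepS_spec i f y)⟩
      choose f' hf' using fun y => mem_cone_iff.1 (hmem y)
      exact length_le_of_app_eq_app (H.stepS i f).2.2 hf'
  reduced_R f f' h := by
    apply Subtype.ext
    funext x
    obtain ⟨a, w, hf⟩ := f.2.1
    have h1 := H.emits a w (Sum.inl f) hf x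
    exact (congrFun hf x).trans (H.eq_of_emits ((h _ _).1 h1) (F := f'.1) rfl)
  reduced_S f f' h :=
    Subtype.ext ((H.act_base f).symm.trans (h.trans (H.act_base f')))

end Admissible

theorem Transducer.LocallyActs.admissible {T : Transducer n} [Finite T.Q]
    {g : CantorR n r → CantorR n r} {K : ℕ} (h : T.LocallyActs g K) (hn : 2 ≤ n)
    (hg : Function.Injective g) : Admissible g where
  two_le := hn
  injective := hg
  continuous := h.continuous
  exists_level := ⟨K, fun a w hw => by
    obtain ⟨q, b, u, -, hu⟩ := h.of_le (a := a) hw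
    exact ⟨b, fun x => by rw [hu]⟩⟩

namespace Admissible

variable {g : CantorR n r → CantorR n r} {T : Transducer n} {K : ℕ}

theorem exists_eq_inr_of_isResidual {a : Fin r} {w : List (Fin n)} {p : RState g ⊕ SState g}
    (hp : IsResidual a w p) {b : Fin r} {F : Cantor n → Cantor n}
    (hF : ∀ x, g (a, app w x) = (b, F x)) : ∃ f, p = Sum.inr f := by
  obtain f | f := p
  · obtain ⟨y, hy⟩ := f.2.2 b
    exact absurd ((congrArg Prod.fst (congrFun hp y)).trans (congrArg Prod.fst (hF y))) hy
  · exact ⟨f, rfl⟩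

/-- A residual of `g` with output is the residual of any map that `g` is locally equal to up to an
exchange of prefixes. -/
theorem eq_of_isResidual {a : Fin r} {w : List (Fin n)} {f : SState g}
    (hf : IsResidual a w (Sum.inr f)) {b : Fin r} {u : List (Fin n)} {F : Cantor n → Cantor n}
    (hF : ∀ i, ∃ y, F y 0 ≠ i) (h : ∀ x, g (a, app w x) = (b, app u (F x))) : f.1 = F := by
  obtain ⟨b', u', h'⟩ := hf
  exact eq_of_app_eq_app f.2.2 hF fun y => (Prod.ext_iff.1 ((h' y).symm.trans (h y))).2

/-- At prefixes where `g` acts by the same state of `T`, it has the same residuals. -/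
theorem eq_of_isResidual_of_act (H : Admissible g) {q : T.Q} {a a' : Fin r} {w w' : List (Fin n)}
    {f f' : SState g} (hf : IsResidual a w (Sum.inr f)) (hf' : IsResidual a' w' (Sum.inr f'))
    {b b' : Fin r} {u u' : List (Fin n)}
    (h : ∀ x, g (a, app w x) = (b, app u (T.act q x)))
    (h' : ∀ x, g (a', app w' x) = (b', app u' (T.act q x))) : f = f' := by
  have hinj : Function.Injective (T.act q) := fun y y' hy => by
    have h1 : g (a, app w y) = g (a, app w y') := by rw [h, h, hy]
    exact app_injective w (Prod.ext_iff.1 (H.injective h1)).2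
  obtain ⟨F, o, ho, hF⟩ := exists_eq_app_of_injective H.two_le hinj
  simp only [ho, ← app_append] at h h'
  exact Subtype.ext ((eq_of_isResidual hf hF h).trans (eq_of_isResidual hf' hF h').symm)

theorem isFinite [Finite T.Q] (H : Admissible g) (hT : T.LocallyActs g K) : H.minimal.IsFinite := by
  have : Finite (RState g) := H.minimal.finite_R
  have hfin : Finite {p : Fin r × List (Fin n) | p.2.length < K} :=
    ((Set.finite_univ (α := Fin r)).prod (List.finite_length_lt (Fin n) K)).subset
      fun p hp => ⟨trivial, hp⟩
  choose a w hw using fun f : SState g => f.2.1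
  choose s b u hs hu using fun (p : Fin r × List (Fin n)) (hp : K ≤ p.2.length) =>
    hT.of_le (a := p.1) hp
  have : Finite (SState g) := by
    refine Finite.of_injective (β := {p : Fin r × List (Fin n) | p.2.length < K} ⊕ T.Q)
      (fun f => if h : (w f).length < K then Sum.inl ⟨(a f, w f), h⟩ else
        Sum.inr (s (a f, w f) (not_lt.1 h))) ?_
    intro f f' hff
    by_cases h : (w f).length < K <;> by_cases h' : (w f').length < K
    · simp only [h, h', dite_true] at hff
      have h1 : a f = a f' ∧ w f = w f' := by simpa using hff
      have h2 := hw f'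
      rw [← h1.1, ← h1.2] at h2
      exact Sum.inr_injective (IsResidual.unique (g := g) (p := Sum.inr f) (p' := Sum.inr f')
        (hw f) h2)
    · simp [h, h'] at hff
    · simp [h, h'] at hff
    · simp only [h, h', dite_false, Sum.inr.injEq] at hff
      have h2 := hu (a f', w f') (not_lt.1 h')
      rw [← hff] at h2
      exact H.eq_of_isResidual_of_act (hw f) (hw f') (hu (a f, w f) (not_lt.1 h)) h2
  exact (inferInstance : Finite (RState g ⊕ SState g))

theorem syncAt [Finite T.Q] (H : Admissible g) (hT : T.LocallyActs g K) [Nonempty (Fin r)] :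
    SyncAt H.minimal.step K := by
  have : Nonempty (H.minimal.R ⊕ H.minimal.base.Q) :=
    ⟨H.minimal.target (H.minimal.init (Classical.arbitrary _))⟩
  refine syncAt_of_readState_eq fun w p p' hw => ?_
  obtain ⟨a, v, rfl⟩ := H.accessible p
  obtain ⟨a', v', rfl⟩ := H.accessible p'
  rw [← readState_append, ← readState_append]
  have h1 := H.isResidual_init a (v ++ w)
  have h2 := H.isResidual_init a' (v' ++ w)
  obtain ⟨q, b, u, hq, hu⟩ := hT.of_le (a := a) (w := v ++ w) (by simp; omega)
  obtain ⟨q', b', u', hq', hu'⟩ := hT.of_le (a := a') (w := v' ++ w) (by simp; omega)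
  obtain ⟨s, -, -, hs, -⟩ := hT a w hw
  obtain rfl : s = q := by rw [← hq q, readState_append, hs]
  obtain rfl : s = q' := by rw [← hq' s, readState_append, hs]
  obtain ⟨f, hf⟩ := exists_eq_inr_of_isResidual h1 hu
  obtain ⟨f', hf'⟩ := exists_eq_inr_of_isResidual h2 hu'
  rw [hf] at h1
  rw [hf'] at h2
  exact hf.trans ((congrArg Sum.inr (H.eq_of_isResidual_of_act h1 h2 hu hu')).trans hf'.symm)

end Admissible

/-- A homeomorphism that acts locally by the states of a finite transducer is induced by a finite
minimal synchronizing transducer. -/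
theorem Transducer.LocallyActs.exists_minimal (hn : 2 ≤ n) (hr : 1 ≤ r) {T : Transducer n}
    [Finite T.Q] {h : CantorR n r ≃ₜ CantorR n r} {K : ℕ} (hT : T.LocallyActs h K) :
    ∃ A : TransducerR n r, A.IsFinite ∧ A.Represents h ∧ A.Synchronizing := by
  have H := hT.admissible hn h.injective
  have : Nonempty (Fin r) := ⟨⟨0, hr⟩⟩
  exact ⟨H.minimal, H.isFinite hT, H.represents, K, H.syncAt hT⟩

/-- The core of the minimal transducer of `h` is isomorphic to `T`, if `h` acts locally by the
states of `T` and these are already reduced. -/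
theorem IsCoreOf.exists_isBiSync (hn : 2 ≤ n) (hr : 1 ≤ r) {T : Transducer n}
    {h : CantorR n r ≃ₜ CantorR n r} {K : ℕ} (hT : IsCoreOf T h K) (hinv : HasSyncInverse h) :
    ∃ A : TransducerR n r, IsBiSync A h ∧ Nonempty (T.Iso A.core) := by
  have := hT.finite
  have H := hT.locallyActs.admissible hn h.injective
  have hne : Nonempty (Fin r) := ⟨⟨0, hr⟩⟩
  have hsync := H.syncAt hT.locallyActs
  obtain ⟨U, L, hU, hUL⟩ := hinv
  refine ⟨H.minimal, ⟨H.isFinite hT.locallyActs, H.isMinimal, H.represents, ⟨K, hsync⟩,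
    hUL.exists_minimal hn hr⟩, ?_⟩
  have hmem : ∀ q : T.Q, ∃ (a : Fin r) (w : List (Fin n)) (b : Fin r) (u : List (Fin n)),
      ∀ y, h (a, app w y) = (b, app u (T.act q y)) := by
    intro q
    obtain ⟨w, hw, hq⟩ := hT.exists_forced q
    obtain ⟨q', b, u, hq', hu⟩ := hT.locallyActs hne.some w hw
    obtain rfl : q' = q := by rw [← hq q, hq']
    exact ⟨_, w, b, u, hu⟩
  let ι : T.Q → SState h := fun q => ⟨T.act q, hmem q, hT.exists_ne q⟩
  have hforced : ∀ (w : List (Fin n)) (q : T.Q), K ≤ w.length →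
      (∀ p, readState T.step w p = q) → ∀ p, readState H.minimal.step w p = Sum.inr (ι q) := by
    intro w q hw hq p
    obtain ⟨a, v, rfl⟩ := H.accessible p
    rw [← readState_append]
    obtain ⟨q', b, u, hq', hu⟩ := hT.locallyActs.of_le (a := a) (w := v ++ w) (by simp; omega)
    obtain rfl : q' = q := by rw [← hq' q, readState_append, hq]
    have h1 := H.isResidual_init a (v ++ w)
    exact IsResidual.unique h1 (p' := Sum.inr (ι q')) ⟨b, u, hu⟩
  have hcore : ∀ q, ι q ∈ H.minimal.coreStates := fun q => by
    obtain ⟨w, hw, hq⟩ := hT.exists_forced q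
    exact ⟨K, hsync, ⟨w, hw⟩, hforced w q hw.ge hq⟩
  have hstep : ∀ (i : Fin n) (q : T.Q), ι (T.step i q) = H.stepS i (ι q) ∧
      T.out i q = H.outS i (ι q) := by
    intro i q
    have h1 : ∀ y, app (T.out i q) (T.act (T.step i q) y) =
        app (H.outS i (ι q)) ((H.stepS i (ι q)).1 y) := fun y => by
      rw [← T.act_app_singleton, ← H.stepS_spec]
    have h2 := eq_of_app_eq_app (hT.exists_ne _) (H.stepS i (ι q)).2.2 h1
    refine ⟨Subtype.ext h2, ?_⟩
    obtain ⟨y⟩ : Nonempty (Cantor n) := ⟨fun _ => ⟨0, by omega⟩⟩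
    exact (app_eq_app_of_length (le_antisymm
      (length_le_of_app_eq_app (H.stepS i (ι q)).2.2 fun y => (h1 y).symm)
      (length_le_of_app_eq_app (hT.exists_ne _) h1)) (h1 y)).1
  refine ⟨⟨Equiv.ofBijective (fun q => (⟨ι q, hcore q⟩ : H.minimal.core.Q)) ⟨?_, ?_⟩, ?_, ?_⟩⟩
  · intro q q' hqq
    exact hT.reduced q q' (congrArg (fun s : H.minimal.core.Q => s.1.1) hqq)
  · rintro ⟨f, k, -, w, hw⟩
    -- Prolonged to the left, the word `w` has length at least `K` and still forces `f`.
    let v : List (Fin n) := List.replicate K ⟨0, by omega⟩ ++ w.1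
    obtain ⟨q, -, -, hq, -⟩ := hT.locallyActs.of_le (a := hne.some) (w := v) (by simp [v])
    refine ⟨q, Subtype.ext ?_⟩
    have h1 := hforced v q (by simp [v]) hq (Sum.inr f)
    have h2 : readState H.minimal.step v (Sum.inr f) = Sum.inr f := by
      rw [readState_append, hw]
    exact Sum.inr_injective (h1.symm.trans h2)
  · intro i q
    exact Subtype.ext (hstep i q).1
  · intro i q
    exact (hstep i q).2

end Minimal

/-! ### Counting cones in partitions -/

section Count

variable {n r : ℕ}

/-- The point `ḃ u x`. -/
def appR (W : Fin r × List (Fin n)) (x : Cantor n) : CantorR n r := (W.1, app W.2 x)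

theorem mem_coneR_some {W : Fin r × List (Fin n)} {z : CantorR n r} :
    z ∈ coneR (some W) ↔ ∃ x, z = appR W x := by
  obtain ⟨b, u⟩ := W
  obtain ⟨c, y⟩ := z
  constructor
  · rintro ⟨h1, h2⟩
    obtain ⟨x, hx⟩ := mem_cone_iff.1 h2
    exact ⟨x, Prod.ext h1 hx⟩
  · rintro ⟨x, hx⟩
    obtain ⟨h1, h2⟩ := Prod.ext_iff.1 hx
    exact ⟨h1, h2 ▸ app_mem_cone _ _⟩

theorem pow_modEq_one (hn : 2 ≤ n) (m : ℕ) : n ^ m ≡ 1 [MOD n - 1] := by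
  have h : n ≡ 1 [MOD n - 1] := (Nat.modEq_iff_dvd' (by omega)).2 (dvd_refl _) |>.symm
  simpa using h.pow m

/-- The number of cones in a partition of the `r` copies of Cantor space is `r` modulo `n - 1`.
Split all cones into cones of words of one large length `L` and count these: a cone `ḃ U_u` splits
into `n ^ (L - |u|)` of them, and `n ≡ 1`. -/
theorem card_modEq_of_partition (hn : 2 ≤ n) {J : Type} [Fintype J] (W : J → Fin r × List (Fin n))
    (hW : ∀ z : CantorR n r, ∃! j, z ∈ coneR (some (W j))) : Fintype.card J ≡ r [MOD n - 1] := by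
  obtain ⟨L, hL⟩ := (Set.finite_range fun j => (W j).2.length).bddAbove
  replace hL : ∀ j, (W j).2.length ≤ L := fun j => hL ⟨j, rfl⟩
  let x₀ : Cantor n := fun _ => ⟨0, by omega⟩
  let F : (Σ j, List.Vector (Fin n) (L - (W j).2.length)) → Fin r × List.Vector (Fin n) L :=
    fun p => ((W p.1).1, ⟨(W p.1).2 ++ p.2.1, by simp [hL p.1]⟩)
  have hF : Function.Bijective F := by
    constructor
    · rintro ⟨j, v, hv⟩ ⟨j', v', hv'⟩ h
      have h1 : (W j).1 = (W j').1 := (Prod.ext_iff.1 h).1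
      have h2 : (W j).2 ++ v = (W j').2 ++ v' := congrArg Subtype.val (Prod.ext_iff.1 h).2
      have e : appR (W j) (app v x₀) = appR (W j') (app v' x₀) :=
        Prod.ext h1 (by simp only [appR, ← app_append, h2])
      obtain rfl : j = j' := (hW (appR (W j) (app v x₀))).unique
        (mem_coneR_some.2 ⟨_, rfl⟩) (mem_coneR_some.2 ⟨_, e⟩)
      have h3 : v = v' := List.append_cancel_left h2
      subst h3
      rfl
    · rintro ⟨a, w, hw⟩
      obtain ⟨j, hj, -⟩ := hW (a, app w x₀)
      obtain ⟨x, hx⟩ := mem_coneR_some.1 hj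
      obtain ⟨h1, h2⟩ := Prod.ext_iff.1 hx
      obtain ⟨v, hv, -⟩ := eq_append_of_app_eq_app ((hL j).trans hw.ge)
        (show app (W j).2 x = app w x₀ from h2.symm)
      refine ⟨⟨j, v, ?_⟩, ?_⟩
      · rw [← hw, hv]; simp
      · exact Prod.ext h1.symm (Subtype.ext hv.symm)
  have hcard := Fintype.card_of_bijective hF
  rw [Fintype.card_sigma, Fintype.card_prod, Fintype.card_fin] at hcard
  simp only [card_vector, Fintype.card_fin] at hcard
  have h1 : ∑ j, n ^ (L - (W j).2.length) ≡ ∑ _j : J, 1 [MOD n - 1] :=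
    Nat.ModEq.sum fun j _ => pow_modEq_one hn _
  rw [hcard] at h1
  have h2 := (pow_modEq_one hn L).mul_left r
  rw [mul_one] at h2
  simpa using h1.symm.trans h2

end Count

/-! ### The images of the states and the signature -/

section Image

variable {n r : ℕ}

theorem Transducer.exists_sig_eq {T : Transducer n} {K : ℕ} (h : SyncAt T.step K) :
    ∃ k ≤ K, ∃ s : List.Vector (Fin n) k → T.Q,
      (∀ (w : List.Vector (Fin n) k) (q : T.Q), readState T.step w.1 q = s w) ∧
        T.sig = ∑ w, T.coverSize (s w) := by
  classical
  have hex : ∃ k, SyncAt T.step k := ⟨K, h⟩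
  refine ⟨Nat.find hex, Nat.find_min' hex h, (Nat.find_spec hex).choose,
    (Nat.find_spec hex).choose_spec, ?_⟩
  unfold Transducer.sig
  rw [dif_pos hex]

variable {T : Transducer n} {h : CantorR n r ≃ₜ CantorR n r} {K : ℕ}

theorem IsCoreOf.injective_act (hT : IsCoreOf T h K) (hr : 1 ≤ r) (q : T.Q) :
    Function.Injective (T.act q) := by
  intro y y' hy
  obtain ⟨w, hw, hq⟩ := hT.exists_forced q
  obtain ⟨q', b, u, hq', hu⟩ := hT.locallyActs ⟨0, hr⟩ w hw
  obtain rfl : q' = q := by rw [← hq q, hq']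
  have h1 : h (⟨0, hr⟩, app w y) = h (⟨0, hr⟩, app w y') := by rw [hu, hu, hy]
  exact app_injective w (Prod.ext_iff.1 (h.injective h1)).2

/-- The inverses of the induced maps `h_q` act locally by the states of any finite transducer by
the states of which the inverse of `h` acts locally. -/
theorem IsCoreOf.exists_local_inverse (hT : IsCoreOf T h K) (hr : 1 ≤ r) {U : Transducer n}
    [Finite U.Q] {L : ℕ} (hU : U.LocallyActs h.symm L) :
    ∃ M, L ≤ M ∧ ∀ (q : T.Q) (v : List (Fin n)) (y : Cantor n), M ≤ v.length →
      T.act q y ∈ cone v → ∃ (s : U.Q) (u : List (Fin n)), (∀ p, readState U.step v p = s) ∧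
        ∀ x, T.act q (app u (U.act s x)) = app v x := by
  obtain ⟨M, hLM, hM⟩ := hU.exists_long K
  refine ⟨L + M, Nat.le_add_right _ _, fun q v y hv hy => ?_⟩
  obtain ⟨w, hw, hq⟩ := hT.exists_forced q
  obtain ⟨q', d, t, hq', ht⟩ := hT.locallyActs ⟨0, hr⟩ w hw
  obtain rfl : q' = q := by rw [← hq q, hq']
  obtain ⟨s, e, u, hu, hs, hsu⟩ := hM d (t ++ v) (by simp; omega)
  obtain ⟨x₀, hx₀⟩ := mem_cone_iff.1 hy
  -- On the cone of `t v`, the inverse of `h` prepends `w` and inverts `h_q`.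
  have h1 : (e, app u (U.act s x₀)) = ((⟨0, hr⟩ : Fin r), app w y) := by
    rw [← hsu, app_append, ← hx₀, ← ht, Homeomorph.symm_apply_apply]
  obtain ⟨h2, h3⟩ := Prod.ext_iff.1 h1
  obtain ⟨u', rfl, -⟩ := eq_append_of_app_eq_app (hw.trans_le hu) h3.symm
  refine ⟨s, u', fun p => ?_, fun x => ?_⟩
  · have h4 := hs p
    rw [readState_append] at h4
    rw [← h4]
    exact (hU.syncAt ⟨0, hr⟩).readState_eq (by omega) _ _
  · have h4 := hsu x
    rw [Homeomorph.symm_apply_eq, show e = ⟨0, hr⟩ from h2, app_append w, ht, app_append] at h4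
    exact (app_injective t (Prod.ext_iff.1 h4).2).symm

/-- The image of an induced map is the disjoint union of `coverSize` many cones. -/
theorem IsCoreOf.exists_code (hT : IsCoreOf T h K) (hr : 1 ≤ r) (hinv : HasSyncInverse h)
    (q : T.Q) : ∃ V : Finset (List (Fin n)), V.card = T.coverSize q ∧
      (∀ z, z ∈ Set.range (T.act q) ↔ ∃ v ∈ V, z ∈ cone v) ∧
        ∀ v ∈ V, ∀ v' ∈ V, ∀ z, z ∈ cone v → z ∈ cone v' → v = v' := by
  classical
  obtain ⟨U, L, hUfin, hU⟩ := hinv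
  obtain ⟨M, -, hM⟩ := hT.exists_local_inverse hr hU
  have hne : {m | ∃ V : Finset (List (Fin n)), V.card = m ∧
      (∀ v ∈ V, cone v ⊆ Set.range (T.act q)) ∧
        Set.range (T.act q) ⊆ ⋃ v ∈ V, cone v}.Nonempty := by
    have hfin : {v : List (Fin n) | v.length = M ∧ ∃ y, T.act q y ∈ cone v}.Finite :=
      (List.finite_length_eq (Fin n) M).subset fun v hv => hv.1
    refine ⟨_, hfin.toFinset, rfl, ?_, ?_⟩
    · intro v hv z hz
      obtain ⟨hv1, y, hy⟩ := (hfin.mem_toFinset).1 hv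
      obtain ⟨s, u, -, hu⟩ := hM q v y hv1.ge hy
      obtain ⟨x, rfl⟩ := mem_cone_iff.1 hz
      exact ⟨_, hu x⟩
    · rintro _ ⟨y, rfl⟩
      simp only [Set.mem_iUnion]
      exact ⟨pre (T.act q y) M, hfin.mem_toFinset.2 ⟨by simp, y, mem_cone_pre _ _⟩,
        mem_cone_pre _ _⟩
  obtain ⟨V, hcard, hsub, hcov⟩ := Nat.sInf_mem hne
  refine ⟨V, hcard, fun z => ⟨fun hz => ?_, ?_⟩, ?_⟩
  · simpa using hcov hz
  · rintro ⟨v, hv, hz⟩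
    exact hsub v hv hz
  · -- Of two nested cones, the smaller one could be omitted.
    have key : ∀ v ∈ V, ∀ v' ∈ V, ∀ z, z ∈ cone v → z ∈ cone v' → v.length ≤ v'.length →
        v = v' := by
      intro v hv v' hv' z hz hz' hle
      by_contra hvv
      have hlt : (V.erase v').card < T.coverSize q := by
        rw [← show V.card = T.coverSize q from hcard]
        exact Finset.card_erase_lt_of_mem hv'
      refine Nat.notMem_of_lt_sInf hlt ⟨V.erase v', rfl,
        fun t ht => hsub t (Finset.mem_of_mem_erase ht), fun z hz1 => ?_⟩
      obtain ⟨t, ht, hzt⟩ : ∃ t ∈ V, z ∈ cone t := by simpa using hcov hz1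
      simp only [Set.mem_iUnion]
      by_cases htv : t = v'
      · subst htv
        exact ⟨v, Finset.mem_erase.2 ⟨hvv, hv⟩, cone_subset_of_mem hle hz hz' hzt⟩
      · exact ⟨t, Finset.mem_erase.2 ⟨htv, ht⟩, hzt⟩
    intro v hv v' hv' z hz hz'
    rcases le_total v.length v'.length with hle | hle
    · exact key v hv v' hv' z hz hz' hle
    · exact (key v' hv' v hv z hz' hz hle).symm

theorem appR_mk_append (b : Fin r) (u v : List (Fin n)) (x : Cantor n) :
    appR (b, u ++ v) x = (b, app u (app v x)) := by
  simp only [appR, app_append]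

/-- The images `h(ȧ U_w)` for all words `w` of a fixed length partition the `r` copies of Cantor
space, and `h(ȧ U_w)` is a union of `m_q` cones, where `q` is the state forced by `w`. -/
theorem IsCoreOf.mul_sig_modEq (hT : IsCoreOf T h K) (hn : 2 ≤ n) (hr : 1 ≤ r)
    (hinv : HasSyncInverse h) : r * T.sig ≡ r [MOD n - 1] := by
  obtain ⟨k, hkK, s, hs, hsig⟩ := Transducer.exists_sig_eq (hT.locallyActs.syncAt ⟨0, hr⟩)
  choose V hVcard hVmem hVuniq using hT.exists_code hr hinv
  have hloc : ∀ (a : Fin r) (t : List.Vector (Fin n) (K - k)) (w : List.Vector (Fin n) k),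
      ∃ (b : Fin r) (u : List (Fin n)),
        ∀ x, h (a, app t.1 (app w.1 x)) = (b, app u (T.act (s w) x)) := by
    intro a t w
    have h1 : t.1.length = K - k := t.2
    have h2 : w.1.length = k := w.2
    obtain ⟨q, b, u, hq, hu⟩ := hT.locallyActs a (t.1 ++ w.1) (by simp; omega)
    obtain rfl : q = s w := by rw [← hq q, readState_append, hs]
    exact ⟨b, u, fun x => by rw [← app_append, hu]⟩
  choose b u hu using hloc
  let J : Type := Σ i : Fin r × List.Vector (Fin n) (K - k) × List.Vector (Fin n) k, V (s i.2.2)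
  let W : J → Fin r × List (Fin n) := fun j =>
    (b j.1.1 j.1.2.1 j.1.2.2, u j.1.1 j.1.2.1 j.1.2.2 ++ j.2.1)
  have hcard : Fintype.card J = r * n ^ (K - k) * T.sig := by
    rw [Fintype.card_sigma, hsig, Fintype.sum_prod_type]
    simp only [Fintype.card_coe, hVcard, Fintype.sum_prod_type, Finset.sum_const, Finset.card_univ,
      card_vector, Fintype.card_fin, smul_eq_mul, mul_assoc]
  have hpart := card_modEq_of_partition hn W ?_
  · rw [hcard] at hpart
    have h1 := ((pow_modEq_one hn (K - k)).mul_left r).mul_right T.sig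
    rw [mul_one] at h1
    exact h1.symm.trans hpart
  · intro z
    have hvec : ∀ (t : List.Vector (Fin n) (K - k)) (w : List.Vector (Fin n) k) (y : Cantor n),
        t.1 = pre (app t.1 (app w.1 y)) (K - k) ∧
          w.1 = pre (tail (K - k) (app t.1 (app w.1 y))) k := by
      rintro ⟨t, ht⟩ ⟨w, hw⟩ y
      simp only [← ht, tail_app, pre_app, true_and]
      simp only [← hw, pre_app]
    refine existsUnique_of_exists_of_unique ?_ ?_
    · obtain ⟨⟨a, x⟩, rfl⟩ := h.surjective z
      let t : List.Vector (Fin n) (K - k) := ⟨pre x (K - k), by simp⟩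
      let w : List.Vector (Fin n) k := ⟨pre (tail (K - k) x) k, by simp⟩
      let y := tail k (tail (K - k) x)
      have hx : x = app t.1 (app w.1 y) := by simp only [t, w, y, app_pre_tail]
      obtain ⟨v, hv, hyv⟩ := (hVmem (s w) _).1 ⟨y, rfl⟩
      obtain ⟨y', hy'⟩ := mem_cone_iff.1 hyv
      refine ⟨⟨(a, t, w), v, hv⟩, mem_coneR_some.2 ⟨y', ?_⟩⟩
      rw [hx, hu, hy', appR_mk_append]
    · have key : ∀ j, z ∈ coneR (some (W j)) → ∃ y : Cantor n,
          h.symm z = (j.1.1, app j.1.2.1.1 (app j.1.2.2.1 y)) ∧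
            T.act (s j.1.2.2) y ∈ cone j.2.1 := by
        rintro ⟨⟨a, t, w⟩, v, hv⟩ hz
        obtain ⟨x, rfl⟩ := mem_coneR_some.1 hz
        obtain ⟨y, hy⟩ := (hVmem (s w) _).2 ⟨v, hv, app_mem_cone v x⟩
        refine ⟨y, ?_, hy ▸ app_mem_cone v x⟩
        rw [Homeomorph.symm_apply_eq, hu, hy, appR_mk_append]
      intro j j' hj hj'
      obtain ⟨y, hy, hyv⟩ := key j hj
      obtain ⟨y', hy', hyv'⟩ := key j' hj'
      obtain ⟨⟨a, t, w⟩, v, hv⟩ := j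
      obtain ⟨⟨a', t', w'⟩, v', hv'⟩ := j'
      rw [hy] at hy'
      obtain ⟨h1, h2⟩ := Prod.ext_iff.1 hy'
      simp only at h1 h2 hyv hyv'
      obtain ⟨e1, e2⟩ := hvec t w y
      obtain ⟨e1', e2'⟩ := hvec t' w' y'
      obtain rfl := h1
      obtain rfl : t = t' := Subtype.ext (by rw [e1, e1', h2])
      obtain rfl : w = w' := Subtype.ext (by rw [e2, e2', h2])
      obtain rfl := app_injective _ (app_injective _ h2)
      obtain rfl := hVuniq _ v hv v' hv' _ hyv hyv'
      rfl

end Image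

/-! ### The lexicographic order and the circle -/

section Order

variable {n r : ℕ}

theorem toLex_lt_iff {x y : Cantor n} :
    toLex x < toLex y ↔ ∃ i, (∀ j < i, x j = y j) ∧ x i < y i := Iff.rfl

/-- A point of the `r` copies of Cantor space, as an element of the lexicographic order. -/
def lexPoint (z : CantorR n r) : Fin r ×ₗ Lex (Cantor n) := toLex (z.1, toLex z.2)

theorem lexPoint_injective : Function.Injective (lexPoint : CantorR n r → _) := fun _ _ h => h

theorem lexPoint_lt_iff {z z' : CantorR n r} :
    lexPoint z < lexPoint z' ↔ z.1 < z'.1 ∨ z.1 = z'.1 ∧ toLex z.2 < toLex z'.2 :=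
  Prod.Lex.toLex_lt_toLex

theorem app_lt_app (u : List (Fin n)) {x y : Cantor n} (h : toLex x < toLex y) :
    toLex (app u x) < toLex (app u y) := by
  obtain ⟨i, hi, hlt⟩ := toLex_lt_iff.1 h
  refine toLex_lt_iff.2 ⟨u.length + i, fun j hj => ?_, by simpa using hlt⟩
  by_cases hju : j < u.length
  · rw [app_of_lt _ _ hju, app_of_lt _ _ hju]
  · rw [app_of_le _ _ (not_lt.1 hju), app_of_le _ _ (not_lt.1 hju), hi _ (by omega)]

/-- Disjoint cones are comparable: if one point of the first lies before one point of the second,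
then all of them do. -/
theorem lexPoint_appR_lt {W W' : Fin r × List (Fin n)}
    (hdis : ∀ z, z ∈ coneR (some W) → z ∉ coneR (some W')) {x x' : Cantor n}
    (h : lexPoint (appR W x) < lexPoint (appR W' x')) (y y' : Cantor n) :
    lexPoint (appR W y) < lexPoint (appR W' y') := by
  obtain ⟨b, u⟩ := W
  obtain ⟨b', u'⟩ := W'
  rw [lexPoint_lt_iff] at h ⊢
  rcases h with h | ⟨rfl, h⟩
  · exact Or.inl h
  refine Or.inr ⟨rfl, ?_⟩
  obtain ⟨i, hi, hlt⟩ := toLex_lt_iff.1 h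
  simp only [appR] at hi hlt
  have hlt_of_le : ∀ {v v' : List (Fin n)} {t t' : Cantor n}, v.length ≤ v'.length →
      (∀ j < i, app v t j = app v' t' j) → (∀ z, z ∈ cone v' → z ∉ cone v) → i < v.length := by
    intro v v' t t' hle hj hd
    by_contra! hcon
    refine hd _ (app_mem_cone v' t') (mem_cone_iff_getElem.2 fun j hjv => ?_)
    rw [← hj j (by omega), app_of_lt _ _ hjv]
  have hboth : i < u.length ∧ i < u'.length := by
    rcases le_total u.length u'.length with hle | hle
    · have := hlt_of_le hle hi fun z hz hz' => hdis (b, z) ⟨rfl, hz'⟩ ⟨rfl, hz⟩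
      omega
    · have := hlt_of_le hle (fun j hj => (hi j hj).symm)
        fun z hz hz' => hdis (b, z) ⟨rfl, hz⟩ ⟨rfl, hz'⟩
      omega
  have h1 : ∀ j ≤ i, app u y j = app u x j := fun j hj => by
    rw [app_of_lt _ _ (by omega), app_of_lt _ _ (by omega)]
  have h2 : ∀ j ≤ i, app u' y' j = app u' x' j := fun j hj => by
    rw [app_of_lt _ _ (by omega), app_of_lt _ _ (by omega)]
  refine toLex_lt_iff.2 ⟨i, fun j hj => ?_, ?_⟩
  · exact (h1 j hj.le).trans ((hi j hj).trans (h2 j hj.le).symm)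
  · show app u y i < app u' y' i
    rw [h1 i le_rfl, h2 i le_rfl]
    exact hlt

/-- A finite family of disjoint cones can be enumerated in increasing order. -/
theorem exists_sorted (hn : 0 < n) {J : Type} [Fintype J] {N : ℕ} (hN : Fintype.card J = N)
    (W : J → Fin r × List (Fin n))
    (hW : ∀ j j' z, z ∈ coneR (some (W j)) → z ∈ coneR (some (W j')) → j = j') :
    ∃ σ : Fin N ≃ J, ∀ p p' : CantorR n N, lexPoint p < lexPoint p' →
      lexPoint (appR (W (σ p.1)) p.2) < lexPoint (appR (W (σ p'.1)) p'.2) := by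
  classical
  let x₀ : Cantor n := fun _ => ⟨0, hn⟩
  have hinj : Function.Injective fun j => lexPoint (appR (W j) x₀) := fun j j' h =>
    hW j j' _ (mem_coneR_some.2 ⟨x₀, rfl⟩) (mem_coneR_some.2 ⟨x₀, lexPoint_injective h⟩)
  let _ : LinearOrder J := LinearOrder.lift' _ hinj
  let σ := Fintype.orderIsoFinOfCardEq J hN
  refine ⟨σ.toEquiv, fun p p' h => ?_⟩
  rcases lexPoint_lt_iff.1 h with h | ⟨h1, h2⟩
  · have h1 : σ p.1 < σ p'.1 := σ.strictMono h
    have h2 : lexPoint (appR (W (σ p.1)) x₀) < lexPoint (appR (W (σ p'.1)) x₀) := h1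
    exact lexPoint_appR_lt (fun z hz hz' => h1.ne (hW _ _ z hz hz')) h2 _ _
  · rw [h1]
    exact lexPoint_lt_iff.2 (Or.inr ⟨rfl, app_lt_app _ h2⟩)

/-- The `r` copies of Cantor space can be partitioned into `r + t (n - 1)` cones: each of `t` steps
splits one cone into `n` cones. -/
theorem exists_partition (hr : 1 ≤ r) (hn : 1 ≤ n) (t : ℕ) :
    ∃ (J : Type) (_ : Fintype J) (W : J → Fin r × List (Fin n)),
      Fintype.card J = r + t * (n - 1) ∧ ∀ z : CantorR n r, ∃! j, z ∈ coneR (some (W j)) := by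
  classical
  induction t with
  | zero =>
    refine ⟨Fin r, inferInstance, fun a => (a, []), by simp, fun z => ⟨z.1, ⟨rfl, ?_⟩, ?_⟩⟩
    · simp [cone, pre]
    · rintro a ⟨h, -⟩
      exact h.symm
  | succ t ih =>
    obtain ⟨J, _, W, hcard, hW⟩ := ih
    obtain ⟨j₀⟩ : Nonempty J := Fintype.card_pos_iff.1 (by omega)
    have hsplit : ∀ z : CantorR n r, z ∈ coneR (some (W j₀)) ↔
        ∃ i, z ∈ coneR (some ((W j₀).1, (W j₀).2 ++ [i])) := by
      intro z
      simp only [mem_coneR_some]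
      constructor
      · rintro ⟨x, rfl⟩
        exact ⟨x 0, shift x, by rw [appR_mk_append, app_zero_shift]; rfl⟩
      · rintro ⟨i, x, rfl⟩
        exact ⟨app [i] x, by rw [appR_mk_append]; rfl⟩
    have huniq : ∀ (z : CantorR n r) (i i' : Fin n),
        z ∈ coneR (some ((W j₀).1, (W j₀).2 ++ [i])) →
          z ∈ coneR (some ((W j₀).1, (W j₀).2 ++ [i'])) → i = i' := by
      intro z i i' hz hz'
      obtain ⟨x, rfl⟩ := mem_coneR_some.1 hz
      obtain ⟨x', h⟩ := mem_coneR_some.1 hz'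
      rw [appR_mk_append, appR_mk_append] at h
      have h1 := congrFun (app_injective _ (Prod.ext_iff.1 h).2) 0
      simpa using h1
    refine ⟨{j // j ≠ j₀} ⊕ Fin n, inferInstance,
      Sum.elim (fun j => W j.1) fun i => ((W j₀).1, (W j₀).2 ++ [i]), ?_, fun z => ?_⟩
    · rw [Fintype.card_sum, Fintype.card_subtype_compl, Fintype.card_fin, hcard,
        Fintype.card_subtype_eq, Nat.succ_mul]
      omega
    · obtain ⟨j, hj, hju⟩ := hW z
      by_cases hjj : j = j₀
      · subst hjj
        obtain ⟨i, hi⟩ := (hsplit z).1 hj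
        refine ⟨Sum.inr i, hi, ?_⟩
        rintro (⟨j', hj'⟩ | i') h
        · exact absurd (hju j' h) hj'
        · exact congrArg Sum.inr (huniq z _ _ h hi)
      · refine ⟨Sum.inl ⟨j, hjj⟩, hj, ?_⟩
        rintro (⟨j', hj'⟩ | i') h
        · exact congrArg Sum.inl (Subtype.ext (hju j' h))
        · exact absurd (hju j₀ ((hsplit z).2 ⟨i', h⟩)).symm hjj

theorem toLex_lt_update {x : Cantor n} {j : ℕ} {c : Fin n} (h : x j < c) :
    toLex x < toLex (Function.update x j c) :=
  toLex_lt_iff.2 ⟨j, fun l hl => by rw [Function.update_of_ne hl.ne], by simpa using h⟩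

theorem toLex_update_lt {x : Cantor n} {j : ℕ} {c : Fin n} (h : c < x j) :
    toLex (Function.update x j c) < toLex x :=
  toLex_lt_iff.2 ⟨j, fun l hl => by rw [Function.update_of_ne hl.ne], by simpa using h⟩

/-- Two points are adjacent on the circle if nothing lies between them, or if they are the last and
the first point of the lexicographic order. -/
theorem adjacent_iff {x y : CantorR n r} : Adjacent x y ↔
    (lexPoint x < lexPoint y ∧ ∀ z, lexPoint x < lexPoint z → ¬ lexPoint z < lexPoint y) ∨
      ((∀ z, ¬ lexPoint x < lexPoint z) ∧ ∀ z, ¬ lexPoint z < lexPoint y) := by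
  obtain ⟨a, x⟩ := x
  obtain ⟨b, y⟩ := y
  constructor
  · simp only [lexPoint_lt_iff, toLex_lt_iff, Adjacent]
    rintro (⟨rfl, m, hm1, hm2, hm3⟩ | ⟨hab, hxy⟩)
    · refine Or.inl ⟨Or.inr ⟨rfl, m, hm1, Fin.lt_def.2 (by omega)⟩, ?_⟩
      rintro ⟨c, z⟩ h1 h2
      simp only at h1 h2
      have hc : c = a := by
        rcases h1 with h1 | h1 <;> rcases h2 with h2 | h2
        · exact absurd (h1.trans h2) (lt_irrefl _)
        · exact h2.1
        · exact h1.1.symm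
        · exact h2.1
      subst hc
      simp only [lt_irrefl, true_and, false_or] at h1 h2
      obtain ⟨i, hi1, hi2⟩ := h1
      obtain ⟨j, hj1, hj2⟩ := h2
      rw [Fin.lt_def] at hi2 hj2
      rcases lt_trichotomy i m with h | rfl | h
      · rcases lt_trichotomy j i with h' | rfl | h'
        · rw [← hi1 j h', hm1 j (by omega)] at hj2; omega
        · rw [hm1 j h] at hi2; omega
        · rw [hm1 i h, hj1 i h'] at hi2; omega
      · rcases lt_trichotomy j i with h' | rfl | h'
        · rw [← hi1 j h', hm1 j h'] at hj2; omega
        · omega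
        · have := (hm3 j h').2; omega
      · have := (hm3 i h).1; have := (z i).2; omega
    · rcases Nat.lt_or_ge ((a : ℕ) + 1) r with hlt | hge
      · rw [Nat.mod_eq_of_lt hlt] at hab
        refine Or.inl ⟨Or.inl (Fin.lt_def.2 (by omega)), ?_⟩
        rintro ⟨c, z⟩ (h1 | ⟨h1, i, -, hi⟩) (h2 | ⟨h2, j, -, hj⟩)
        · rw [Fin.lt_def] at h1 h2; simp only at h1 h2; omega
        · have := (hxy j).2; rw [Fin.lt_def] at hj; simp only at hj; omega
        · have := (hxy i).1; have := (z i).2; rw [Fin.lt_def] at hi; simp only at hi; omega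
        · have := (hxy j).2; rw [Fin.lt_def] at hj; simp only at hj; omega
      · have har : (a : ℕ) + 1 = r := le_antisymm a.2 hge
        rw [har, Nat.mod_self] at hab
        refine Or.inr ⟨?_, ?_⟩
        · rintro ⟨c, z⟩ (h1 | ⟨h1, i, -, hi⟩)
          · rw [Fin.lt_def] at h1; simp only at h1; have := c.2; omega
          · have := (hxy i).1; have := (z i).2; rw [Fin.lt_def] at hi; simp only at hi; omega
        · rintro ⟨c, z⟩ (h1 | ⟨h1, i, -, hi⟩)
          · rw [Fin.lt_def] at h1; simp only at h1; omega
          · have := (hxy i).2; rw [Fin.lt_def] at hi; simp only at hi; omega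
  · -- Changing one letter gives a point in between, unless `x` ends in `n - 1` and `y` in `0`.
    have hup : ∀ j, (x j : ℕ) + 1 ≠ n → ∃ c : Fin n, (c : ℕ) = x j + 1 := fun j hj =>
      ⟨⟨x j + 1, by have := (x j).2; omega⟩, rfl⟩
    have hdown : ∀ j, (y j : ℕ) ≠ 0 → ∃ c : Fin n, (c : ℕ) = 0 := fun j _ =>
      ⟨⟨0, by have := (y j).2; omega⟩, rfl⟩
    have hxlt : ∀ {j} {c : Fin n}, (c : ℕ) = x j + 1 →
        lexPoint (a, x) < lexPoint (a, Function.update x j c) := fun hc =>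
      lexPoint_lt_iff.2 (Or.inr ⟨rfl, toLex_lt_update (show x _ < _ from Fin.lt_def.2 (by omega))⟩)
    have hylt : ∀ {j} {c : Fin n}, (y j : ℕ) ≠ 0 → (c : ℕ) = 0 →
        lexPoint (b, Function.update y j c) < lexPoint (b, y) := fun hj hc =>
      lexPoint_lt_iff.2 (Or.inr ⟨rfl, toLex_update_lt (show _ < y _ from Fin.lt_def.2 (by omega))⟩)
    rintro (⟨hlt, hcov⟩ | ⟨hmax, hmin⟩)
    · rcases lexPoint_lt_iff.1 hlt with hab | ⟨hab, hlex⟩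
      · have hab' : (a : ℕ) < b := hab
        have h1 : (a : ℕ) + 1 = b := by
          by_contra hne
          refine hcov (⟨a + 1, by have := b.2; omega⟩, y) (lexPoint_lt_iff.2 (Or.inl ?_))
            (lexPoint_lt_iff.2 (Or.inl ?_)) <;> rw [Fin.lt_def] <;> simp only <;> omega
        refine Or.inr ⟨?_, fun j => ⟨?_, ?_⟩⟩
        · rw [h1]
          exact Nat.mod_eq_of_lt b.2
        · by_contra hne
          obtain ⟨c, hc⟩ := hup j hne
          exact hcov _ (hxlt hc) (lexPoint_lt_iff.2 (Or.inl hab))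
        · by_contra hne
          obtain ⟨c, hc⟩ := hdown j hne
          exact hcov (b, Function.update y j c) (lexPoint_lt_iff.2 (Or.inl hab)) (hylt hne hc)
      · obtain rfl : a = b := hab
        obtain ⟨m, hm1, hm2⟩ := toLex_lt_iff.1 hlex
        replace hm1 : ∀ j < m, x j = y j := hm1
        replace hm2 : (x m : ℕ) < y m := hm2
        refine Or.inl ⟨rfl, m, hm1, ?_, fun j hj => ⟨?_, ?_⟩⟩
        · by_contra hne
          replace hne : (x m : ℕ) + 1 ≠ y m := hne
          obtain ⟨c, hc⟩ := hup m (by have := (y m).2; omega)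
          refine hcov _ (hxlt hc) (lexPoint_lt_iff.2 (Or.inr ⟨rfl, m, fun l hl => ?_, ?_⟩))
          · exact (Function.update_of_ne hl.ne _ _).trans (hm1 l hl)
          · show Function.update x m c m < y m
            rw [Function.update_self, Fin.lt_def]
            omega
        · by_contra hne
          obtain ⟨c, hc⟩ := hup j hne
          refine hcov _ (hxlt hc) (lexPoint_lt_iff.2 (Or.inr ⟨rfl, m, fun l hl => ?_, ?_⟩))
          · exact (Function.update_of_ne (by omega) _ _).trans (hm1 l hl)
          · show Function.update x j c m < y m
            rwa [Function.update_of_ne (by omega)]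
        · by_contra hne
          obtain ⟨c, hc⟩ := hdown j hne
          refine hcov (a, Function.update y j c)
            (lexPoint_lt_iff.2 (Or.inr ⟨rfl, m, fun l hl => ?_, ?_⟩)) (hylt hne hc)
          · exact (hm1 l hl).trans (Function.update_of_ne (by omega) _ _).symm
          · show x m < Function.update y j c m
            rwa [Function.update_of_ne (by omega)]
    · have h1 : (a : ℕ) + 1 = r := by
        by_contra hne
        refine hmax (⟨a + 1, by have := a.2; omega⟩, x) (lexPoint_lt_iff.2 (Or.inl ?_))
        rw [Fin.lt_def]
        simp
      have h2 : (b : ℕ) = 0 := by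
        by_contra hne
        refine hmin (⟨0, by omega⟩, y) (lexPoint_lt_iff.2 (Or.inl ?_))
        rw [Fin.lt_def]
        simp only
        omega
      refine Or.inr ⟨?_, fun j => ⟨?_, ?_⟩⟩
      · simp only
        rw [h1, h2, Nat.mod_self]
      · by_contra hne
        obtain ⟨c, hc⟩ := hup j hne
        exact hmax _ (hxlt hc)
      · by_contra hne
        obtain ⟨c, hc⟩ := hdown j hne
        exact hmin _ (hylt hne hc)

/-- Strictly monotone bijections preserve the circle relation. -/
theorem circleEq_of_strictMono {h : CantorR n r → CantorR n r} (hs : Function.Surjective h)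
    (hh : ∀ z z', lexPoint z < lexPoint z' → lexPoint (h z) < lexPoint (h z'))
    {x y : CantorR n r} (hxy : CircleEq x y) : CircleEq (h x) (h y) := by
  have hiff : ∀ z z', lexPoint (h z) < lexPoint (h z') ↔ lexPoint z < lexPoint z' := by
    refine fun z z' => ⟨fun hlt => ?_, hh z z'⟩
    rcases lt_trichotomy (lexPoint z) (lexPoint z') with h1 | h1 | h1
    · exact h1
    · rw [lexPoint_injective h1] at hlt
      exact absurd hlt (lt_irrefl _)
    · exact absurd (hlt.trans (hh _ _ h1)) (lt_irrefl _)
  have key : ∀ {x y}, Adjacent x y → Adjacent (h x) (h y) := by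
    intro x y hadj
    rcases adjacent_iff.1 hadj with ⟨h1, h2⟩ | ⟨h1, h2⟩
    · exact adjacent_iff.2 (Or.inl ⟨hh _ _ h1, hs.forall.2 fun z hz hz' =>
        h2 z ((hiff _ _).1 hz) ((hiff _ _).1 hz')⟩)
    · exact adjacent_iff.2 (Or.inr ⟨hs.forall.2 fun z hz => h1 z ((hiff _ _).1 hz),
        hs.forall.2 fun z hz => h2 z ((hiff _ _).1 hz)⟩)
  rcases hxy with rfl | hxy | hxy
  · exact Or.inl rfl
  · exact Or.inr (Or.inl (key hxy))
  · exact Or.inr (Or.inr (key hxy))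

/-- Strictly antitone bijections preserve the circle relation. -/
theorem circleEq_of_strictAnti {h : CantorR n r → CantorR n r} (hs : Function.Surjective h)
    (hh : ∀ z z', lexPoint z < lexPoint z' → lexPoint (h z') < lexPoint (h z))
    {x y : CantorR n r} (hxy : CircleEq x y) : CircleEq (h x) (h y) := by
  have hiff : ∀ z z', lexPoint (h z') < lexPoint (h z) ↔ lexPoint z < lexPoint z' := by
    refine fun z z' => ⟨fun hlt => ?_, hh z z'⟩
    rcases lt_trichotomy (lexPoint z) (lexPoint z') with h1 | h1 | h1
    · exact h1
    · rw [lexPoint_injective h1] at hlt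
      exact absurd hlt (lt_irrefl _)
    · exact absurd (hlt.trans (hh _ _ h1)) (lt_irrefl _)
  have key : ∀ {x y}, Adjacent x y → Adjacent (h y) (h x) := by
    intro x y hadj
    rcases adjacent_iff.1 hadj with ⟨h1, h2⟩ | ⟨h1, h2⟩
    · exact adjacent_iff.2 (Or.inl ⟨hh _ _ h1, hs.forall.2 fun z hz hz' =>
        h2 z ((hiff _ _).1 hz') ((hiff _ _).1 hz)⟩)
    · exact adjacent_iff.2 (Or.inr ⟨hs.forall.2 fun z hz => h2 z ((hiff _ _).1 hz),
        hs.forall.2 fun z hz => h1 z ((hiff _ _).1 hz)⟩)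
  rcases hxy with rfl | hxy | hxy
  · exact Or.inl rfl
  · exact Or.inr (Or.inr (key hxy))
  · exact Or.inr (Or.inl (key hxy))

end Order

/-! ### Homeomorphisms with a prescribed core -/

section Realize

variable {n r : ℕ}

/-- The map `ȧ x y ↦ ρ(a) τ(x) h_q(y)`, where `x` has length `k`, `q` is the state `s x`, and `τ`
acts letter by letter. -/
noncomputable def twist (T : Transducer n) {k : ℕ} (s : List.Vector (Fin n) k → T.Q)
    (ρ : Fin r → Fin r) (τ : Fin n → Fin n) (z : CantorR n r) : CantorR n r :=
  (ρ z.1, app ((pre z.2 k).map τ) (T.act (s ⟨pre z.2 k, length_pre _ _⟩) (tail k z.2)))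

variable {T : Transducer n} {k : ℕ} {s : List.Vector (Fin n) k → T.Q} {ρ : Fin r → Fin r}
  {τ : Fin n → Fin n}

theorem twist_app (a : Fin r) (x : List.Vector (Fin n) k) (y : Cantor n) :
    twist T s ρ τ (a, app x.1 y) = (ρ a, app (x.1.map τ) (T.act (s x) y)) := by
  obtain ⟨x, rfl⟩ := x
  simp only [twist, pre_app, tail_app]

theorem exists_eq_app_vector (k : ℕ) (z : CantorR n r) :
    ∃ (x : List.Vector (Fin n) k) (y : Cantor n), z = (z.1, app x.1 y) :=
  ⟨⟨pre z.2 k, length_pre _ _⟩, tail k z.2, Prod.ext rfl (app_pre_tail z.2 k).symm⟩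

theorem exists_lt_or_eq_app (k : ℕ) {x y : Cantor n} (h : toLex x < toLex y) :
    (∃ i < k, (∀ j < i, x j = y j) ∧ x i < y i) ∨
      ∃ (p : List.Vector (Fin n) k) (x' y' : Cantor n),
        x = app p.1 x' ∧ y = app p.1 y' ∧ toLex x' < toLex y' := by
  obtain ⟨i, hi, hlt⟩ := toLex_lt_iff.1 h
  rcases lt_or_ge i k with hik | hik
  · exact Or.inl ⟨i, hik, hi, hlt⟩
  · refine Or.inr ⟨⟨pre x k, length_pre _ _⟩, tail k x, tail k y, (app_pre_tail x k).symm, ?_,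
      toLex_lt_iff.2 ⟨i - k, fun j hj => hi (j + k) (by omega), ?_⟩⟩
    · have : pre x k = pre y k := by
        apply List.ext_getElem
        · simp
        · intro j h1 h2
          rw [getElem_pre, getElem_pre]
          exact hi j (by simp at h1; omega)
      simp only [this, app_pre_tail]
    · simpa only [tail, Nat.sub_add_cancel hik] using hlt

theorem app_map_pre (τ : Fin n → Fin n) (x y : Cantor n) {j k : ℕ} (hj : j < k) :
    app ((pre x k).map τ) y j = τ (x j) := by
  rw [app_of_lt _ _ (by simpa using hj), List.getElem_map, getElem_pre]

theorem lexPoint_twist_lt (hρ : StrictMono ρ) (hτ : StrictMono τ) (hT : T.PreservesLex)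
    {z z' : CantorR n r} (h : lexPoint z < lexPoint z') :
    lexPoint (twist T s ρ τ z) < lexPoint (twist T s ρ τ z') := by
  obtain ⟨a, x⟩ := z
  obtain ⟨b, y⟩ := z'
  rcases lexPoint_lt_iff.1 h with h1 | ⟨h1, h2⟩
  · exact lexPoint_lt_iff.2 (Or.inl (hρ h1))
  obtain rfl : a = b := h1
  rcases exists_lt_or_eq_app k h2 with ⟨i, hik, hi, hlt⟩ | ⟨p, x', y', e, e', hlt⟩
  · refine lexPoint_lt_iff.2 (Or.inr ⟨rfl, toLex_lt_iff.2 ⟨i, fun j hj => ?_, ?_⟩⟩)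
    · exact (app_map_pre τ x _ (hj.trans hik)).trans
        ((congrArg τ (hi j hj)).trans (app_map_pre τ y _ (hj.trans hik)).symm)
    · exact (app_map_pre τ x _ hik).trans_lt ((hτ hlt).trans_eq (app_map_pre τ y _ hik).symm)
  · rw [show x = _ from e, show y = _ from e', twist_app, twist_app]
    exact lexPoint_lt_iff.2 (Or.inr ⟨rfl, app_lt_app _ (hT _ _ _ hlt)⟩)

theorem lexPoint_twist_gt (hρ : StrictAnti ρ) (hτ : StrictAnti τ) (hT : T.ReversesLex)
    {z z' : CantorR n r} (h : lexPoint z < lexPoint z') :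
    lexPoint (twist T s ρ τ z') < lexPoint (twist T s ρ τ z) := by
  obtain ⟨a, x⟩ := z
  obtain ⟨b, y⟩ := z'
  rcases lexPoint_lt_iff.1 h with h1 | ⟨h1, h2⟩
  · exact lexPoint_lt_iff.2 (Or.inl (hρ h1))
  obtain rfl : a = b := h1
  rcases exists_lt_or_eq_app k h2 with ⟨i, hik, hi, hlt⟩ | ⟨p, x', y', e, e', hlt⟩
  · refine lexPoint_lt_iff.2 (Or.inr ⟨rfl, toLex_lt_iff.2 ⟨i, fun j hj => ?_, ?_⟩⟩)
    · exact (app_map_pre τ y _ (hj.trans hik)).trans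
        ((congrArg τ (hi j hj).symm).trans (app_map_pre τ x _ (hj.trans hik)).symm)
    · exact (app_map_pre τ y _ hik).trans_lt ((hτ hlt).trans_eq (app_map_pre τ x _ hik).symm)
  · rw [show x = _ from e, show y = _ from e', twist_app, twist_app]
    exact lexPoint_lt_iff.2 (Or.inr ⟨rfl, app_lt_app _ (hT _ _ _ hlt)⟩)

/-- If `r sig(T) ≡ r`, then the images of `twist` can be cut into as many cones as there are cones
in some partition of the `r` copies of Cantor space. Matching the cones in increasing order turns
`twist` into a homeomorphism with core `T`. -/
theorem IsCoreOf.exists_twist {t K : ℕ} {f : CantorR n t ≃ₜ CantorR n t} (hT : IsCoreOf T f K)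
    (hinv : HasSyncInverse f) (hn : 2 ≤ n) (ht : 1 ≤ t) (hr : 1 ≤ r)
    (hs : ∀ (w : List.Vector (Fin n) k) (q : T.Q), readState T.step w.1 q = s w)
    (hsig : r * ∑ w, T.coverSize (s w) ≡ r [MOD n - 1])
    (hρ : Function.Bijective ρ) (hτ : Function.Injective τ) :
    ∃ (h : CantorR n r ≃ₜ CantorR n r) (L : ℕ), IsCoreOf T h L ∧ HasSyncInverse h ∧
      ∀ z z', lexPoint (twist T s ρ τ z) < lexPoint (twist T s ρ τ z') →
        lexPoint (h z) < lexPoint (h z') := by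
  have hfin := hT.finite
  choose V hVcard hVmem hVuniq using hT.exists_code ht hinv
  obtain ⟨U, L, hUfin, hU⟩ := hinv
  obtain ⟨M, hLM, hM⟩ := hT.exists_local_inverse ht hU
  set g := twist T s ρ τ with hg
  have hne : ∀ q, (V q).Nonempty := fun q => by
    obtain ⟨v, hv, -⟩ := (hVmem q _).1 ⟨fun _ => ⟨0, by omega⟩, rfl⟩
    exact ⟨v, hv⟩
  -- The cones that make up the image of `g`.
  let J : Type := Σ i : Fin r × List.Vector (Fin n) k, V (s i.2)
  let W : J → Fin r × List (Fin n) := fun j => (ρ j.1.1, j.1.2.1.map τ ++ j.2.1)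
  have hcardJ : Fintype.card J = r * ∑ w, T.coverSize (s w) := by
    rw [Fintype.card_sigma, Fintype.sum_prod_type]
    simp [hVcard]
  have hWdis : ∀ j j' z, z ∈ coneR (some (W j)) → z ∈ coneR (some (W j')) → j = j' := by
    rintro ⟨⟨a, x⟩, v, hv⟩ ⟨⟨a', x'⟩, v', hv'⟩ z hz hz'
    obtain ⟨y, rfl⟩ := mem_coneR_some.1 hz
    obtain ⟨y', e⟩ := mem_coneR_some.1 hz'
    simp only [W, appR_mk_append] at e
    obtain ⟨e1, e2⟩ := Prod.ext_iff.1 e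
    obtain rfl := hρ.1 e1
    obtain ⟨e3, e4⟩ := app_eq_app_of_length
      (by rw [List.length_map, List.length_map, x.2, x'.2]) e2
    obtain rfl : x = x' := Subtype.ext (List.map_injective_iff.2 hτ e3)
    obtain rfl := hVuniq _ v hv v' hv' _ (app_mem_cone v y) (e4 ▸ app_mem_cone v' y')
    rfl
  obtain ⟨m, hm⟩ : ∃ m, r * ∑ w, T.coverSize (s w) = r + m * (n - 1) := by
    have hpos : 1 ≤ ∑ w, T.coverSize (s w) := by
      let w₀ : List.Vector (Fin n) k := ⟨List.replicate k ⟨0, by omega⟩, by simp⟩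
      have h1 : 1 ≤ T.coverSize (s w₀) := by
        rw [← hVcard]
        exact (hne _).card_pos
      exact h1.trans (Finset.single_le_sum (f := fun w => T.coverSize (s w))
        (fun _ _ => Nat.zero_le _) (Finset.mem_univ w₀))
    have hle : r ≤ r * ∑ w, T.coverSize (s w) := Nat.le_mul_of_pos_right r hpos
    obtain ⟨m, hm⟩ := (Nat.modEq_iff_dvd' hle).1 hsig.symm
    exact ⟨m, by rw [mul_comm m]; omega⟩
  obtain ⟨J', _, W', hcardJ', hW'⟩ := exists_partition (n := n) hr (by omega) m
  obtain ⟨σ, hσ⟩ := exists_sorted (by omega) (hcardJ.trans hm) W hWdis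
  obtain ⟨σ', hσ'⟩ := exists_sorted (by omega) hcardJ' W' fun j j' z hj hj' => (hW' z).unique hj hj'
  let N := r + m * (n - 1)
  let Ψ : CantorR n N → CantorR n r := fun p => appR (W (σ p.1)) p.2
  let Φ : CantorR n N → CantorR n r := fun p => appR (W' (σ' p.1)) p.2
  have hΨ : ∀ i j y, σ i = j → Ψ (i, y) = (ρ j.1.1, app (j.1.2.1.map τ) (app j.2.1 y)) := by
    rintro i _ y rfl
    exact appR_mk_append _ _ _ _
  have inj_of_lt : ∀ F : CantorR n N → CantorR n r,
      (∀ p p', lexPoint p < lexPoint p' → lexPoint (F p) < lexPoint (F p')) →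
        Function.Injective F := by
    intro F hF p p' hp
    by_contra hpp
    rcases lt_or_gt_of_ne (lexPoint_injective.ne hpp) with h | h
    · exact (hF _ _ h).ne (congrArg lexPoint hp)
    · exact (hF _ _ h).ne (congrArg lexPoint hp.symm)
  have hΨinj : Function.Injective Ψ := inj_of_lt Ψ hσ
  have hΦ : Function.Bijective Φ := by
    refine ⟨inj_of_lt Φ hσ', fun z => ?_⟩
    obtain ⟨j, hj, -⟩ := hW' z
    obtain ⟨y, hy⟩ := mem_coneR_some.1 hj
    exact ⟨(σ'.symm j, y), by simp only [Φ, Equiv.apply_symm_apply, hy]⟩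
  have hΨg : ∀ z, ∃ p, Ψ p = g z := by
    intro z
    obtain ⟨x, y, hz⟩ := exists_eq_app_vector k z
    obtain ⟨v, hv, hyv⟩ := (hVmem (s x) _).1 ⟨y, rfl⟩
    obtain ⟨y', hy'⟩ := mem_cone_iff.1 hyv
    refine ⟨(σ.symm ⟨(z.1, x), v, hv⟩, y'), ?_⟩
    rw [hz, hg, twist_app, hΨ _ _ _ (σ.apply_symm_apply _), hy']
  have hgΨ : ∀ p, ∃ z, g z = Ψ p := by
    rintro ⟨i, y⟩
    obtain ⟨⟨⟨a, x⟩, v, hv⟩, hi⟩ : ∃ j, j = σ i := ⟨_, rfl⟩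
    obtain ⟨y', hy'⟩ := (hVmem (s x) _).2 ⟨v, hv, app_mem_cone v y⟩
    refine ⟨(a, app x.1 y'), ?_⟩
    rw [hg, twist_app, hy', hΨ _ _ _ hi.symm]
  have hginj : Function.Injective g := by
    intro z z' hzz
    obtain ⟨x, y, hz⟩ := exists_eq_app_vector k z
    obtain ⟨x', y', hz'⟩ := exists_eq_app_vector k z'
    rw [hz, hz', hg, twist_app, twist_app] at hzz
    obtain ⟨e1, e2⟩ := Prod.ext_iff.1 hzz
    obtain ⟨e3, e4⟩ := app_eq_app_of_length
      (by rw [List.length_map, List.length_map, x.2, x'.2]) e2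
    obtain rfl : x = x' := Subtype.ext (List.map_injective_iff.2 hτ e3)
    rw [hz, hz', hρ.1 e1, hT.injective_act ht _ e4]
  choose e he using hΨg
  have hebij : Function.Bijective e := by
    refine ⟨fun z z' hzz => hginj (by rw [← he, hzz, he]), fun p => ?_⟩
    obtain ⟨z, hz⟩ := hgΨ p
    exact ⟨z, hΨinj (by rw [he, hz])⟩
  let h : CantorR n r ≃ CantorR n r := Equiv.ofBijective (Φ ∘ e) (hΦ.comp hebij)
  have hkey : ∀ z p, g z = Ψ p → h z = Φ p := fun z p hzp =>
    congrArg Φ (hΨinj ((he z).trans hzp))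
  -- Long inputs make the output of `g` pass through one of the cones.
  have hlocT : ∃ L', T.LocallyActs h L' := by
    obtain ⟨c, hc⟩ := (Set.finite_range fun j : J => j.2.1.length).bddAbove
    obtain ⟨M', hM'⟩ := T.exists_le_length_readOut c
    refine ⟨k + M', fun a w hw => ?_⟩
    obtain ⟨x, w', hxw, hw'⟩ : ∃ (x : List.Vector (Fin n) k) (w' : List (Fin n)),
        w = x.1 ++ w' ∧ w'.length = M' :=
      ⟨⟨w.take k, by simp; omega⟩, w.drop k, (List.take_append_drop k w).symm, by simp; omega⟩
    obtain ⟨v, hv, hyv⟩ := (hVmem (s x) _).1 ⟨app w' fun _ => ⟨0, by omega⟩, rfl⟩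
    rw [T.act_app] at hyv
    have hvc : v.length ≤ c := hc ⟨⟨(a, x), v, hv⟩, rfl⟩
    obtain ⟨y', hy'⟩ := mem_cone_iff.1 hyv
    obtain ⟨o, ho, -⟩ := eq_append_of_app_eq_app (hvc.trans (hM' _ _ hw'.ge)) hy'.symm
    obtain ⟨i, hi⟩ := σ.surjective ⟨(a, x), v, hv⟩
    refine ⟨readState T.step w' (s x), (W' (σ' i)).1, (W' (σ' i)).2 ++ o, fun p => ?_, fun y => ?_⟩
    · rw [hxw, readState_append, hs]
    · rw [hkey _ (i, app o (T.act (readState T.step w' (s x)) y))]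
      · simp only [Φ, appR, app_append]
      · rw [hxw, app_append, hg, twist_app, T.act_app, ho]
        rw [hΨ _ _ _ hi, app_append]
  have hlocU : ∃ L', U.LocallyActs h.symm L' := by
    obtain ⟨c, hc⟩ := (Set.finite_range fun i => (W' (σ' i)).2.length).bddAbove
    refine ⟨c + M, fun b u hu => ?_⟩
    obtain ⟨⟨i, y⟩, hiy⟩ := hΦ.2 (b, app u fun _ => ⟨0, by omega⟩)
    obtain ⟨hb, hy⟩ := Prod.ext_iff.1 hiy
    replace hy : app (W' (σ' i)).2 y = app u fun _ => ⟨0, by omega⟩ := hy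
    have hic : (W' (σ' i)).2.length ≤ c := hc ⟨i, rfl⟩
    obtain ⟨u', hu', -⟩ := eq_append_of_app_eq_app (hic.trans (by omega)) hy
    have hu'M : M ≤ u'.length := by
      rw [hu', List.length_append] at hu
      omega
    obtain ⟨⟨⟨a, x⟩, v, hv⟩, hi⟩ : ∃ j, j = σ i := ⟨_, rfl⟩
    obtain ⟨y', hy'⟩ := (hVmem (s x) _).2
      ⟨v, hv, app_mem_cone v (app u' fun _ => ⟨0, by omega⟩)⟩
    obtain ⟨p, t', hp, ht'⟩ := hM (s x) (v ++ u') y' (by simp; omega)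
      (by rw [hy', ← app_append]; exact app_mem_cone _ _)
    refine ⟨p, a, x.1 ++ t', fun p' => ?_, fun y => ?_⟩
    · rw [← hp p', hu', readState_append, readState_append]
      exact (hU.syncAt ⟨0, ht⟩).readState_eq (hLM.trans hu'M) _ _
    · rw [Equiv.symm_apply_eq, hkey _ (i, app u' y)]
      · rw [hu', app_append]
        exact Prod.ext hb.symm rfl
      · rw [app_append, hg, twist_app, ht']
        rw [hΨ _ _ _ hi.symm, app_append]
  obtain ⟨L₁, hL₁⟩ := hlocT
  obtain ⟨L₂, hL₂⟩ := hlocU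
  let h' : CantorR n r ≃ₜ CantorR n r := ⟨h, hL₁.continuous, hL₂.continuous⟩
  refine ⟨h', max L₁ K, ⟨hfin, hT.exists_ne, hT.reduced, fun q => ?_, ?_⟩,
    ⟨U, L₂, hUfin, hL₂⟩, fun z z' hzz => ?_⟩
  · obtain ⟨w, hw, hq⟩ := hT.exists_forced q
    refine ⟨List.replicate (max L₁ K - K) ⟨0, by omega⟩ ++ w, by simp [hw], fun p => ?_⟩
    rw [readState_append, hq]
  · exact hL₁.mono (le_max_left _ _)
  · rw [← he, ← he] at hzz
    refine hσ' _ _ ?_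
    rcases lt_trichotomy (lexPoint (e z)) (lexPoint (e z')) with h1 | h1 | h1
    · exact h1
    · rw [lexPoint_injective h1] at hzz
      exact absurd hzz (lt_irrefl _)
    · exact absurd (hzz.trans (hσ _ _ h1)) (lt_irrefl _)

end Realize

/-! ### Membership in the sets of cores -/

section Membership

variable {n r : ℕ} {T : Transducer n}

theorem mul_sig_modEq_of_mem_Onr (hr : 1 ≤ r) (hrn : r < n) (h : T ∈ Onr n r) :
    r * T.sig ≡ r [MOD n - 1] := by
  obtain ⟨A, f, hA, ⟨e⟩⟩ := h
  obtain ⟨K, hK⟩ := hA.exists_isCoreOf (by omega) e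
  exact hK.mul_sig_modEq (by omega) hr (hA.hasSyncInverse (by omega))

/-- If the congruence holds, then `T` is the core of elements of `B_{n,r}` that compare points as
the maps `twist` do. -/
theorem exists_isBiSync_of_modEq (hr : 1 ≤ r) (hrn : r < n) (hT : T ∈ On n)
    (hmod : r * T.sig ≡ r [MOD n - 1]) {ρ : Fin r → Fin r} {τ : Fin n → Fin n}
    (hρ : Function.Bijective ρ) (hτ : Function.Injective τ) :
    ∃ (A : TransducerR n r) (h : CantorR n r ≃ₜ CantorR n r),
      IsBiSync A h ∧ Nonempty (T.Iso A.core) ∧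
        ∃ (k : ℕ) (s : List.Vector (Fin n) k → T.Q), ∀ z z' : CantorR n r,
          lexPoint (twist T s ρ τ z) < lexPoint (twist T s ρ τ z') →
            lexPoint (h z) < lexPoint (h z') := by
  obtain ⟨t, ht, htn, B, f, hB, ⟨e⟩⟩ := hT
  obtain ⟨K, hK⟩ := hB.exists_isCoreOf (by omega) e
  have hinv := hB.hasSyncInverse (by omega)
  obtain ⟨k, -, s, hs, hsig⟩ := Transducer.exists_sig_eq (hK.locallyActs.syncAt ⟨0, ht⟩)
  rw [hsig] at hmod
  obtain ⟨h, L, hL, hinv', hlt⟩ := hK.exists_twist hinv (by omega) ht hr hs hmod hρ hτ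
  obtain ⟨A, hA, hiso⟩ := hL.exists_isBiSync (by omega) hr hinv'
  exact ⟨A, h, hA, hiso, k, s, hlt⟩

theorem mem_Onr_of_modEq (hr : 1 ≤ r) (hrn : r < n) (hT : T ∈ On n)
    (hmod : r * T.sig ≡ r [MOD n - 1]) : T ∈ Onr n r := by
  obtain ⟨A, h, hA, hiso, -⟩ := exists_isBiSync_of_modEq hr hrn hT hmod
    (Function.bijective_id (α := Fin r)) (Function.injective_id (α := Fin n))
  exact ⟨A, h, hA, hiso⟩

theorem mem_TOnr_of_modEq (hr : 1 ≤ r) (hrn : r < n) (hT : T ∈ TOn n)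
    (hmod : r * T.sig ≡ r [MOD n - 1]) : T ∈ TOnr n r := by
  obtain ⟨hT, hlex | hlex⟩ := hT
  · obtain ⟨A, h, hA, hiso, k, s, hlt⟩ := exists_isBiSync_of_modEq hr hrn hT hmod
      (Function.bijective_id (α := Fin r)) (Function.injective_id (α := Fin n))
    exact ⟨A, h, hA, fun x y => circleEq_of_strictMono h.surjective fun z z' hz =>
      hlt _ _ (lexPoint_twist_lt strictMono_id strictMono_id hlex hz), hiso⟩
  · -- The prefixes are reversed as well, so that the whole homeomorphism reverses the order.
    obtain ⟨A, h, hA, hiso, k, s, hlt⟩ := exists_isBiSync_of_modEq hr hrn hT hmod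
      (Fin.rev_bijective (n := r)) (Fin.rev_injective (n := n))
    exact ⟨A, h, hA, fun x y => circleEq_of_strictAnti h.surjective fun z z' hz =>
      hlt _ _ (lexPoint_twist_gt Fin.rev_strictAnti Fin.rev_strictAnti hlex hz), hiso⟩

end Membership

end HT

theorem mainTheorem4 (n r : ℕ) (hr : 1 ≤ r) (hrn : r < n) (T : HT.Transducer n) :
    (T ∈ HT.TOn n → (T ∈ HT.TOnr n r ↔ r * T.sig ≡ r [MOD n - 1])) ∧
    (T ∈ HT.On n → (T ∈ HT.Onr n r ↔ r * T.sig ≡ r [MOD n - 1])) ∧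
    (r * T.sig ≡ r [MOD n - 1] ↔ (r : ℤ) * ((T.sig : ℤ) - 1) ≡ 0 [ZMOD (n : ℤ) - 1]) := by
  refine ⟨fun hT => ⟨?_, HT.mem_TOnr_of_modEq hr hrn hT⟩,
    fun hT => ⟨HT.mul_sig_modEq_of_mem_Onr hr hrn, HT.mem_Onr_of_modEq hr hrn hT⟩, ?_⟩
  · rintro ⟨A, h, hA, -, hiso⟩
    exact HT.mul_sig_modEq_of_mem_Onr hr hrn ⟨A, h, hA, hiso⟩
  · rw [← Int.natCast_modEq_iff, Int.modEq_comm, Int.modEq_iff_dvd, Int.modEq_zero_iff_dvd,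
      Nat.cast_sub (by omega)]
    push_cast
    rw [mul_sub, mul_one]
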